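/- Let $\varepsilon\in(0,1)$ with $1/\varepsilon\in\mathbb Z$, $\phi>1$, $\psi\in[0,1]$, $\rho=10$. **Instance and schedules.** An instance $I$ has $n$ jobs with sizes $p_j>0$ and resource requirements $d_j\ge 0$, $m$ machines with speeds $s_i\in(0,1]$, the largest speed being $1$, and $e\ge 1$ replenishment dates $u_1<\dots<u_e$ with supplied quantities $q_k\ge 0$. It is rounded: all $p_j,s_i,u_k$ are integer powers of $1+\varepsilon$. A schedule assigns to each job $j$ a machine $i$ and a starting time $\ge 0$; job $j$ is then processed without interruption for $p_j/s_i$ time units. It is feasible if jobs on a common machine do not overlap and, for every time $t$, $\sum_{j\text{ starts before }t}d_j\le\sum_{k:u_k<t}q_k$ (strictly before $t$ in both sums). With $\Lambda_i$ the completion time of the last job of machine $i$ ($0$ if there is none), the cost of the schedule is $\psi\max_i\Lambda_i+(1-\psi)\sum_i\Lambda_i^\phi$. **Guess and parameters.** The guessed information is a pair $(C_{opt},s_{opt})$, where $C_{opt}$ is an integer power of $1+\varepsilon$ and $s_{opt}\ge\varepsilon^2$ is the speed of a machine. A job $j$ is huge for $(s,w)$ if $p_j/s>(1+\varepsilon)w$,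 big if $\varepsilon^\rho w\le p_j/s\le(1+\varepsilon)w$, and small if $p_j/s<\varepsilon^\rho w$. Write $\log$ for $\log_{1+\varepsilon}$. Let $\tilde\mu=\lceil\log\frac1\varepsilon+2\rceil$. For $w$ an integer power of $1+\varepsilon$ let $\delta=\lceil\log(\varepsilon^\rho w)\rceil$ and $\lambda=\lceil\log((1+\varepsilon)w)\rceil-\delta+1$ ($\lambda$ does not depend on $w$), and let $$\kappa=\frac{\varepsilon s_{opt}}{(1+2\varepsilon)\left(\frac{1+\varepsilon}{\varepsilon^\rho}+1\right)^{\tilde\mu(\lambda+1)}\frac{(1+\varepsilon)^3}{\varepsilon^2}}.$$ **Configurations.** For $k\in\mathbb Z$, period $k$ is the time interval from $(1+\varepsilon)^k$ to $(1+\varepsilon)^{k+1}$. A configuration $c$ consists of a machine speed $s_c$ of $I$, a load bound $w_c\le(1+\varepsilon)C_{opt}$ that is an integer power of $1+\varepsilon$, and, for every $k\in K_c=\{\lfloor\log(\varepsilon w_c)\rfloor,\dots,\lceil\log((1+\varepsilon)w_c)\rceil\}$, nonnegative integers $B_c(k,r)$ ($1\le r\le\lambda$) and $S_c(k)$. With $\delta_c=\lceil\log(\varepsilon^\rho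 w_c)\rceil$, its generated schedule deals with the periods $k\in K_c$ in increasing order, starting period $k$ at the maximum of $(1+\varepsilon)^k$ and the completion time of the earlier periods, and processing without idle time first a virtual job of processing time $S_c(k)\varepsilon^\rho w_c$ and then $B_c(k,r)$ big jobs of processing time $(1+\varepsilon)^{\delta_c+r-1}$ for $r=1,\dots,\lambda$. The configuration is feasible if in every period $k$ at most one of the big jobs of that period is completed after time $(1+\varepsilon)^{k+1}$, and all jobs are completed by time $(1+\varepsilon)w_c$. **MILP.** Let $C$ be any finite set of feasible configurations, let $K=\{k\in\mathbb Z:\ u_1\le(1+\varepsilon)^k\le(1+\varepsilon)C_{opt}\}$, and let $q(k)$ be the quantity supplied at time $(1+\varepsilon)^k$ ($0$ if this is not a replenishment date). The MILP has variables $z_c$ ($c\in C$) and $x_{jkc}$ ($1\le j\le n$, $k\in K$, $c\in C$; read $x_{jkc}=0$ for $k\notin K$). It minimizes $\psi C_{opt}+(1-\psi)\sum_{c\in C}z_cw_c^\phi$ subject to 1. $\sum_{c\in C:\,j\text{ not huge for }(s_c,w_c)}\ \sum_{k\in K_c}x_{jkc}=1$ for all $j$; 2. $\sum_{j\text{ big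 for }(s_c,w_c),\ p_j/s_c=(1+\varepsilon)^{\delta_c+r-1}}x_{jkc}=z_cB_c(k,r)$ for all $c\in C$, $k\in K_c$, $1\le r\le\lambda$; 3. $\sum_{j\text{ small for }(s_c,w_c)}x_{jkc}\,p_j\le z_cs_c(S_c(k)+1)\varepsilon^\rho w_c$ for all $c\in C$, $k\in K_c$; 4. $\sum_{c\in C:\,s_c=s}z_c=|\{i:s_i=s\}|$ for every machine speed $s$; 5. $\sum_{c\in C}\sum_{k'\in K,\,k'\le k}\sum_j x_{jk'c}\,d_j\le\sum_{k'\in K,\,k'\le k}q(k')$ for all $k\in K$; 6. $\sum_{c\in C:\,s_c=s_{opt},\ (1+\varepsilon)w_c\ge C_{opt}}z_c\ge1$; 7. $0\le x_{jkc}\le1$ for all $j$, $k\in K$, $c\in C$; $z_c\ge0$ for all $c\in C$; and $z_c\in\mathbb Z$ whenever $s_c\ge\kappa$ and $w_c\ge\kappa C_{opt}$. **Theorem.** For every rounded instance $I$, every guess $(C_{opt},s_{opt})$ and every feasible solution $(x,z)$ of the MILP, there is a feasible schedule of $I$ whose cost is at most $(1+6\varepsilon)^\phi$ times the objective value of $(x,z)$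 in the MILP. -/

import Mathlib

open Finset

noncomputable section

namespace UMS

/-- An instance of non-preemptive scheduling on uniformly related machines with one non-renewable
resource: `n` jobs with sizes `p` and resource requirements `d`, `m` machines with speeds `s`
(the fastest one has speed `1`), and `e` replenishment dates `u` with supplied quantities `q`. -/
structure Instance where
  n : ℕ
  m : ℕ
  e : ℕ
  p : Fin n → ℝ
  d : Fin n → ℝ
  s : Fin m → ℝ
  u : Fin e → ℝ
  q : Fin e → ℝ
  e_pos : 0 < e
  p_pos : ∀ j, 0 < p j
  d_nonneg : ∀ j, 0 ≤ d j
  s_pos : ∀ i, 0 < s i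
  s_le_one : ∀ i, s i ≤ 1
  exists_s_eq_one : ∃ i, s i = 1
  u_nonneg : ∀ k, 0 ≤ u k
  u_strictMono : StrictMono u
  q_nonneg : ∀ k, 0 ≤ q k

/-- The first replenishment date. -/
def Instance.u₁ (I : Instance) : ℝ := I.u ⟨0, I.e_pos⟩

/-- `x` is an integer power of `1 + ε`. -/
def IsPow (ε x : ℝ) : Prop := ∃ a : ℤ, x = (1 + ε) ^ a

/-- A rounded instance: job sizes, machine speeds and replenishment dates are integer powers of
`1 + ε`. -/
structure Instance.IsRounded (ε : ℝ) (I : Instance) : Prop where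
  p_pow : ∀ j, IsPow ε (I.p j)
  s_pow : ∀ i, IsPow ε (I.s i)
  u_pow : ∀ k, IsPow ε (I.u k)

/-! ### Schedules -/

/-- A job assignment: every job receives a machine and a starting time. -/
structure Schedule (I : Instance) where
  machine : Fin I.n → Fin I.m
  start : Fin I.n → ℝ

namespace Schedule

variable {I : Instance}

/-- The completion time of job `j`, which is processed without interruption. -/
def completion (σ : Schedule I) (j : Fin I.n) : ℝ :=
  σ.start j + I.p j / I.s (σ.machine j)

/-- Feasibility: jobs start at nonnegative times, jobs on a common machine do not overlap, and the
resource needed by the jobs started strictly before `t` has been supplied strictly before `t`. -/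
structure IsFeasible (σ : Schedule I) : Prop where
  start_nonneg : ∀ j, 0 ≤ σ.start j
  no_overlap : ∀ j j', j ≠ j' → σ.machine j = σ.machine j' →
    σ.completion j ≤ σ.start j' ∨ σ.completion j' ≤ σ.start j
  resource : ∀ t : ℝ,
    ∑ j ∈ univ.filter (fun j => σ.start j < t), I.d j ≤
      ∑ k ∈ univ.filter (fun k => I.u k < t), I.q k

/-- The load of a machine: the completion time of its last job (`0` if it has no job). -/
def load (σ : Schedule I) (i : Fin I.m) : ℝ :=
  (univ.filter (fun j => σ.machine j = i)).fold max 0 σ.completion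

/-- The makespan: the largest load. -/
def makespan (σ : Schedule I) : ℝ := univ.fold max 0 σ.load

/-- The objective: the convex combination, with coefficient `ψ`, of the makespan and of the sum of
the `φ`-th powers of the loads. -/
def obj (ψ φ : ℝ) (σ : Schedule I) : ℝ :=
  ψ * σ.makespan + (1 - ψ) * ∑ i, σ.load i ^ φ

end Schedule

/-! ### Parameters depending on `ε` -/

/-- The constant `ρ`. -/
def rho : ℕ := 10

/-- `⌈log_{1+ε} (1/ε) + 2⌉`, the number of periods of a configuration. -/
def muTilde (ε : ℝ) : ℕ := ⌈Real.logb (1 + ε) (1 / ε) + 2⌉₊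

/-- `Δ = ⌈log_{1+ε} ((1+ε) w)⌉`. -/
def bigDelta (ε w : ℝ) : ℤ := ⌈Real.logb (1 + ε) ((1 + ε) * w)⌉

/-- `δ = ⌈log_{1+ε} (ε^ρ w)⌉`. -/
def smallDelta (ε w : ℝ) : ℤ := ⌈Real.logb (1 + ε) (ε ^ rho * w)⌉

/-- `λ = Δ - δ + 1`, the number of distinct sizes of big jobs. -/
def lam (ε w : ℝ) : ℕ := (bigDelta ε w - smallDelta ε w + 1).toNat

/-- The threshold `κ` for large loads and fast speeds. The number `λ` is the same for all load
bounds that are integer powers of `1 + ε`, and is taken at `w = 1`. -/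
def kappa (ε sopt : ℝ) : ℝ :=
  ε * sopt / ((1 + 2 * ε) * ((1 + ε) / ε ^ rho + 1) ^ (muTilde ε * (lam ε 1 + 1)) *
    ((1 + ε) ^ 3 / ε ^ 2))

/-! ### Huge, big and small jobs -/

/-- A job of size `p` is huge for the pair `(s, w)`. -/
def IsHuge (ε p s w : ℝ) : Prop := (1 + ε) * w < p / s

/-- A job of size `p` is big for the pair `(s, w)`. -/
def IsBig (ε p s w : ℝ) : Prop := ε ^ rho * w ≤ p / s ∧ p / s ≤ (1 + ε) * w

/-- A job of size `p` is small for the pair `(s, w)`. -/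
def IsSmall (ε p s w : ℝ) : Prop := p / s < ε ^ rho * w

/-! ### Configurations

Period `k : ℤ` is the time interval from `(1 + ε) ^ k` to `(1 + ε) ^ (k + 1)`. -/

/-- A configuration: speed, load bound, the number `B k r` of big jobs of processing time
`(1 + ε) ^ (δ + r - 1)` started in period `k`, and the rounded down amount `S k` of small jobs
started in period `k`, in units of `ε^ρ w` of processing time. -/
structure Config where
  s : ℝ
  w : ℝ
  B : ℤ → ℕ → ℕ
  S : ℤ → ℕ

namespace Config

/-- `ν^l = ⌊log_{1+ε} (ε w)⌋`, the first period of a configuration. -/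
def nuL (ε : ℝ) (c : Config) : ℤ := ⌊Real.logb (1 + ε) (ε * c.w)⌋

/-- `ν^u = ⌈log_{1+ε} ((1+ε) w)⌉`, the last period of a configuration. -/
def nuU (ε : ℝ) (c : Config) : ℤ := ⌈Real.logb (1 + ε) ((1 + ε) * c.w)⌉

/-- The set `K_c` of periods of a configuration. -/
def periods (ε : ℝ) (c : Config) : Finset ℤ := Finset.Icc (c.nuL ε) (c.nuU ε)

/-- The indices `r` of the processing times of big jobs. -/
def bigIdx (ε : ℝ) (c : Config) : Finset ℕ := Finset.Icc 1 (lam ε c.w)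

/-- The processing time, on a machine of speed `c.s`, of the big jobs with index `r`. -/
def bigTime (ε : ℝ) (c : Config) (r : ℕ) : ℝ := (1 + ε) ^ (smallDelta ε c.w + (r : ℤ) - 1)

/-- The processing times of the big jobs started in period `k`, in non-decreasing order. -/
def bigList (ε : ℝ) (c : Config) (k : ℤ) : List ℝ :=
  (List.range (lam ε c.w)).flatMap fun i => List.replicate (c.B k (i + 1)) (c.bigTime ε (i + 1))

/-- The processing time of the virtual job (representing small jobs) of period `k`. -/
def virtTime (ε : ℝ) (c : Config) (k : ℤ) : ℝ := c.S k * (ε ^ rho * c.w)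

/-- The generated schedule of one machine: `c.finish ε i` is the time at which the first `i` periods
of the configuration, `ν^l, …, ν^l + i - 1`, are dealt with. In period `k` the virtual job and then
the big jobs are processed without idle time, starting at the maximum of the starting time of the
period and the time at which the earlier periods are dealt with. -/
def finish (ε : ℝ) (c : Config) : ℕ → ℝ
  | 0 => (1 + ε) ^ c.nuL ε
  | i + 1 => max ((1 + ε) ^ (c.nuL ε + (i : ℤ))) (finish ε c i) +
      c.virtTime ε (c.nuL ε + (i : ℤ)) + (c.bigList ε (c.nuL ε + (i : ℤ))).sum

/-- The time at which the first big job of period `k` starts in the generated schedule. -/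
def bigStart (ε : ℝ) (c : Config) (k : ℤ) : ℝ :=
  max ((1 + ε) ^ k) (c.finish ε (k - c.nuL ε).toNat) + c.virtTime ε k

/-- The time at which all jobs of period `k` are completed in the generated schedule. -/
def periodEnd (ε : ℝ) (c : Config) (k : ℤ) : ℝ :=
  c.bigStart ε k + (c.bigList ε k).sum

/-- The feasible configurations for the instance `I` and the guessed makespan `Copt`. -/
structure IsFeasible (ε : ℝ) (I : Instance) (Copt : ℝ) (c : Config) : Prop where
  /-- The first component is the speed of a machine. -/
  speed : ∃ i, I.s i = c.s
  /-- The load bound is an integer power of `1 + ε`. -/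
  load_pow : IsPow ε c.w
  /-- Loads up to `(1 + ε) Copt` are considered. -/
  load_le : c.w ≤ (1 + ε) * Copt
  /-- The components of the vector are indexed by `K_c` and `1, …, λ_c`. -/
  B_support : ∀ k r, ¬ (k ∈ c.periods ε ∧ r ∈ c.bigIdx ε) → c.B k r = 0
  S_support : ∀ k, k ∉ c.periods ε → c.S k = 0
  /-- In each period at most one big job is processed beyond the end of the period. -/
  crossing : ∀ k ∈ c.periods ε,
    ((Finset.range (c.bigList ε k).length).filter fun i =>
      (1 + ε) ^ (k + 1) < c.bigStart ε k + ((c.bigList ε k).take (i + 1)).sum).card ≤ 1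
  /-- All jobs of the generated schedule are completed in `[ε w, (1 + ε) w]`, up to rounding of its
  left end point. -/
  completed : ∀ k ∈ c.periods ε, (c.S k ≠ 0 ∨ c.bigList ε k ≠ []) →
    c.periodEnd ε k ≤ (1 + ε) * c.w

end Config

/-! ### The mixed-integer linear program -/

/-- Admissible guessed information: `Copt` is an integer power of `1 + ε`, and `sopt` is the speed
of a machine and is at least `ε ^ 2`. -/
structure IsGuess (ε : ℝ) (I : Instance) (Copt sopt : ℝ) : Prop where
  Copt_pow : IsPow ε Copt
  sopt_speed : ∃ i, I.s i = sopt
  sopt_ge : ε ^ 2 ≤ sopt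

/-- The set `K` of universal periods, from `log_{1+ε} u₁` to `log_{1+ε} Copt + 1` (both logarithms
are integers for a rounded instance). -/
def universalPeriods (ε : ℝ) (I : Instance) (Copt : ℝ) : Finset ℤ :=
  Finset.Icc ⌈Real.logb (1 + ε) I.u₁⌉ ⌊Real.logb (1 + ε) Copt + 1⌋

/-- The quantity of resource supplied at the beginning of period `k` (possibly zero). -/
def supply (ε : ℝ) (I : Instance) (k : ℤ) : ℝ :=
  ∑ v ∈ univ.filter (fun v => I.u v = (1 + ε) ^ k), I.q v

open scoped Classical in
/-- `(x, z)` is a feasible solution of the configuration MILP over the configurations in `C`. The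
variables `x j k c` are present for `k ∈ K` only, so they are zero for other `k`. -/
structure IsMILPSolution (ε : ℝ) (I : Instance) (Copt sopt : ℝ) (C : Finset Config)
    (x : Fin I.n → ℤ → Config → ℝ) (z : Config → ℝ) : Prop where
  x_support : ∀ j, ∀ c ∈ C, ∀ k, k ∉ universalPeriods ε I Copt → x j k c = 0
  assigned : ∀ j,
    ∑ c ∈ C.filter (fun c => ¬ IsHuge ε (I.p j) c.s c.w), ∑ k ∈ c.periods ε, x j k c = 1
  big_jobs : ∀ c ∈ C, ∀ k ∈ c.periods ε, ∀ r ∈ c.bigIdx ε,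
    ∑ j ∈ univ.filter (fun j => IsBig ε (I.p j) c.s c.w ∧ I.p j / c.s = c.bigTime ε r), x j k c =
      z c * c.B k r
  small_jobs : ∀ c ∈ C, ∀ k ∈ c.periods ε,
    ∑ j ∈ univ.filter (fun j => IsSmall ε (I.p j) c.s c.w), x j k c * I.p j ≤
      z c * c.s * ((c.S k : ℝ) + 1) * (ε ^ rho * c.w)
  machines : ∀ i,
    ∑ c ∈ C.filter (fun c => c.s = I.s i), z c =
      ((univ.filter fun i' => I.s i' = I.s i).card : ℝ)
  resource : ∀ k ∈ universalPeriods ε I Copt,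
    ∑ c ∈ C, ∑ k' ∈ (universalPeriods ε I Copt).filter (fun k' => k' ≤ k), ∑ j, x j k' c * I.d j ≤
      ∑ k' ∈ (universalPeriods ε I Copt).filter (fun k' => k' ≤ k), supply ε I k'
  guessing : 1 ≤ ∑ c ∈ C.filter (fun c => c.s = sopt ∧ Copt ≤ (1 + ε) * c.w), z c
  x_bounds : ∀ c ∈ C, ∀ k ∈ universalPeriods ε I Copt, ∀ j, 0 ≤ x j k c ∧ x j k c ≤ 1
  z_nonneg : ∀ c ∈ C, 0 ≤ z c
  z_integer : ∀ c ∈ C, kappa ε sopt ≤ c.s → kappa ε sopt * Copt ≤ c.w → ∃ a : ℤ, z c = a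

/-- The objective value of a solution of the MILP. -/
def milpCost (ψ φ Copt : ℝ) (C : Finset Config) (z : Config → ℝ) : ℝ :=
  ψ * Copt + (1 - ψ) * ∑ c ∈ C, z c * c.w ^ φ

end UMS

end

/-!
Rounding a solution of the configuration MILP to a schedule rests on the fact that jobs of equal
size are interchangeable: they are huge, big or small for the same configurations and have the same
processing times, and differ in their resource requirements only. For each size, let the jobs be
sorted by requirement and the pairs of a period and a configuration by period, and let the `i`-th
job enter the pair in which the accumulated fractional number of jobs of this size reaches `i`
(`exists_rounding`). Then an initial segment of periods gets the cheapest `⌊Y⌋` jobs of the size,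
where `Y` is their fractional number, so the resource constraints are kept, and each pair gets less
than one job more than in the fractional solution.

Configuration `c` is used in `⌈z c⌉` copies (`IsMILPSolution.exists_copies`). The number of big jobs
of one kind was `z c * B k r`, so after rounding it is at most `⌈z c⌉ * B k r`, and no copy needs
more than its `B k r` big jobs. The additional small jobs, at most one of each size, form a geometric
series, and greedy balancing costs one small job per copy. Hence a copy exceeds the content of each
period by at most `ε ^ ρ (3 + 1 / ε) w`, which over all periods amounts to at most `ε w`, and the
jobs from any period on fit between its start and `(1 + 2 ε) w`. This condition alone yields a
schedule: all jobs are processed in the order of their periods, without idle time, and right-justified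
at the deadline (`exists_schedule`).

The `⌊z c⌋` integral copies are placed on distinct machines of their speeds. The remaining fractional
copies, at most one for each configuration that is slow or has a small load bound, take time at most
`2 ε Copt` in total on a machine of speed `sopt`, because there are boundedly many configurations for
given speed and load bound, and both parameters are powers of `1 + ε`
(`sum_slow_or_light_le`). They all go to a machine of speed `sopt` whose load bound is at least
`Copt / (1 + ε)`, which exists since the corresponding variables are integral. Every used machine
then has a load of at most `(1 + 6 ε) w`, and of at most `(1 + 6 ε) Copt`.
-/

open Finset

noncomputable section

namespace UMS

/-! ### Rounding a fractional assignment of interchangeable jobs -/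

/-- The `⌊Y⌋` smallest values weigh at most as much as any fractional selection of total size
`Y = ∑ i, X i`. -/
theorem sum_smallest_le {N : ℕ} {d : Fin N → ℝ} (hd : Monotone d) (hd0 : ∀ i, 0 ≤ d i)
    {X : Fin N → ℝ} (h0 : ∀ i, 0 ≤ X i) (h1 : ∀ i, X i ≤ 1) :
    ∑ i ∈ univ.filter (fun i : Fin N => ((i : ℕ) : ℝ) + 1 ≤ ∑ i, X i), d i ≤ ∑ i, X i * d i := by
  set Y := ∑ i, X i with hY
  set T := univ.filter (fun i : Fin N => ((i : ℕ) : ℝ) + 1 ≤ Y) with hT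
  have hY0 : 0 ≤ Y := sum_nonneg fun i _ => h0 i
  have hcard : (T.card : ℝ) ≤ Y := by
    have : T.card ≤ (range ⌊Y⌋₊).card := by
      refine card_le_card_of_injOn (fun i => (i : ℕ)) ?_ (fun a _ b _ h => Fin.ext h)
      intro i hi
      have hi' : ((i : ℕ) : ℝ) + 1 ≤ Y := by simpa [hT] using hi
      simp only [coe_range, Set.mem_Iio]
      exact Nat.lt_of_succ_le (Nat.le_floor (by push_cast; exact hi'))
    rw [card_range] at this
    exact (Nat.cast_le.2 this).trans (Nat.floor_le hY0)
  rcases T.eq_empty_or_nonempty with h | hne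
  · rw [h, sum_empty]
    exact sum_nonneg fun i _ => mul_nonneg (h0 i) (hd0 i)
  -- Exchange argument at the threshold `τ`, the largest of the smallest values.
  set τ := d (T.max' hne)
  have key : ∀ i, (if i ∈ T then d i else 0) - X i * d i ≤ τ * ((if i ∈ T then 1 else 0) - X i) := by
    intro i
    split_ifs with hi
    · have : d i ≤ τ := hd (le_max' _ _ hi)
      nlinarith [h1 i]
    · have : τ ≤ d i := by
        refine hd ?_
        by_contra hlt
        push Not at hlt
        refine hi ?_
        have hm := T.max'_mem hne
        simp only [hT, mem_filter, mem_univ, true_and] at hm ⊢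
        have : ((i : ℕ) : ℝ) ≤ ((T.max' hne : Fin N) : ℕ) := by exact_mod_cast hlt.le
        linarith
      nlinarith [h0 i]
  have := sum_le_sum fun i (_ : i ∈ univ) => key i
  rw [← mul_sum, sum_sub_distrib, sum_sub_distrib, sum_ite_mem, sum_ite_mem, univ_inter, ← hY,
    sum_const, nsmul_eq_mul, mul_one] at this
  have : τ * (T.card - Y) ≤ 0 := mul_nonpos_of_nonneg_of_nonpos (hd0 _) (by linarith)
  linarith

/-- Every function on a finite type into a linear order has a non-decreasing enumeration. -/
theorem exists_equiv_monotone {ι α : Type*} [Fintype ι] [LinearOrder α] (f : ι → α) :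
    ∃ (N : ℕ) (e : Fin N ≃ ι), Monotone fun i => f (e i) := by
  classical
  let e₀ := (Fintype.equivFin ι).symm
  exact ⟨_, (Tuple.sort (f ∘ e₀)).trans e₀, Tuple.monotone_sort (f ∘ e₀)⟩

/-- Jobs `J` are fractionally assigned to slots `A`, and slot `a` belongs to period `κ a`. They can
be assigned integrally such that the number of jobs in a slot grows by less than one and no initial
segment of periods consumes more of the resource. Jobs are taken by non-decreasing requirement,
slots by non-decreasing period, and the `i`-th job enters the slot in which the accumulated fractional
number of jobs reaches `i`. -/
theorem exists_rounding {J A : Type*} [Fintype J] [Fintype A] [DecidableEq A] (κ : A → ℤ)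
    (d : J → ℝ) (hd0 : ∀ j, 0 ≤ d j) (x : J → A → ℝ) (hx0 : ∀ j a, 0 ≤ x j a)
    (hx1 : ∀ j, ∑ a, x j a = 1) :
    ∃ g : J → A, (∀ a, ((univ.filter fun j => g j = a).card : ℝ) < ∑ j, x j a + 1) ∧
      ∀ k, ∑ j with κ (g j) ≤ k, d j ≤ ∑ j, (∑ a with κ a ≤ k, x j a) * d j := by
  obtain ⟨N, e, he⟩ := exists_equiv_monotone d
  obtain ⟨M, f, hf⟩ := exists_equiv_monotone κ
  set y : A → ℝ := fun a => ∑ j, x j a with hy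
  have hy0 : ∀ a, 0 ≤ y a := fun a => sum_nonneg fun j _ => hx0 j a
  have hytot : ∑ a, y a = N := by
    rw [hy, sum_comm]
    simp [hx1, Fintype.card_congr e.symm]
  -- `Y l` is the fractional number of jobs in the first `l` slots.
  set Y : ℕ → ℝ := fun l => ∑ i ∈ univ.filter (fun i : Fin M => (i : ℕ) < l), y (f i) with hYdef
  have hYM : Y M = N := by
    rw [← hytot, ← Equiv.sum_comp f]
    simp [hYdef]
  have hYmono : Monotone Y := by
    intro a b hab
    refine sum_le_sum_of_subset_of_nonneg (fun i hi => ?_) fun i _ _ => hy0 _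
    simp only [mem_filter, mem_univ, true_and] at hi ⊢
    omega
  have hYsucc : ∀ l : Fin M, Y (l + 1) = Y l + y (f l) := by
    intro l
    have : univ.filter (fun i : Fin M => (i : ℕ) < l + 1) =
        insert l (univ.filter fun i : Fin M => (i : ℕ) < l) := by
      ext i
      simp only [mem_filter, mem_univ, true_and, mem_insert, Fin.ext_iff]
      omega
    simp only [hYdef]
    rw [this, sum_insert (by simp), add_comm]
  have hY0 : Y 0 = 0 := by simp [hYdef]
  have hex : ∀ i : Fin N, ∃ l : Fin M, Y l < (i : ℕ) + 1 ∧ ((i : ℕ) : ℝ) + 1 ≤ Y (l + 1) := by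
    intro i
    have h : ∃ l, ((i : ℕ) : ℝ) + 1 ≤ Y l := ⟨M, by
      rw [hYM]; exact_mod_cast i.2⟩
    classical
    have h1 := Nat.find_spec h
    have hpos : Nat.find h ≠ 0 := by
      intro h0
      rw [h0, hY0] at h1
      have : (0 : ℝ) ≤ ((i : ℕ) : ℝ) := Nat.cast_nonneg _
      linarith
    have hle : Nat.find h ≤ M := Nat.find_min' h (by rw [hYM]; exact_mod_cast i.2)
    refine ⟨⟨Nat.find h - 1, by omega⟩, ?_, ?_⟩
    · have := Nat.find_min h (m := Nat.find h - 1) (by omega)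
      push Not at this
      exact this
    · simp only
      rw [Nat.sub_add_cancel (by omega)]
      exact h1
  choose s hs1 hs2 using hex
  refine ⟨fun j => f (s (e.symm j)), fun a => ?_, fun k => ?_⟩
  · set l := f.symm a
    have hfl : f l = a := f.apply_symm_apply a
    have h1 : (univ.filter fun j => f (s (e.symm j)) = a).card ≤
        (Ico ⌊Y l⌋₊ ⌊Y (l + 1)⌋₊).card := by
      refine card_le_card_of_injOn (fun j => ((e.symm j : Fin N) : ℕ)) ?_
        (fun j _ j' _ h => e.symm.injective (Fin.ext h))
      intro j hj
      have hj' : s (e.symm j) = l := by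
        have : f (s (e.symm j)) = a := by simpa using hj
        rw [← f.symm_apply_apply (s (e.symm j)), this]
      have h1 := hs1 (e.symm j)
      have h2 := hs2 (e.symm j)
      rw [hj'] at h1 h2
      simp only [coe_Ico, Set.mem_Ico]
      constructor
      · rw [← Nat.lt_succ_iff]
        exact (Nat.floor_lt' (by omega)).2 (by push_cast; exact h1)
      · exact Nat.lt_of_succ_le (Nat.le_floor (by push_cast; exact h2))
    rw [Nat.card_Ico] at h1
    have hYl0 : 0 ≤ Y l := hY0 ▸ hYmono (Nat.zero_le _)
    have hle : ⌊Y l⌋₊ ≤ ⌊Y (l + 1)⌋₊ := Nat.floor_le_floor (hYmono (Nat.le_succ _))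
    have h2 : ((univ.filter fun j => f (s (e.symm j)) = a).card : ℝ) ≤
        (⌊Y (l + 1)⌋₊ : ℝ) - ⌊Y l⌋₊ := by
      rw [← Nat.cast_sub hle]; exact_mod_cast h1
    have h3 := Nat.floor_le (hYl0.trans (hYmono (Nat.le_succ (l : ℕ))))
    have h4 := Nat.lt_floor_add_one (Y l)
    have h5 := hYsucc l
    rw [hfl] at h5
    change Y (l + 1) = Y l + ∑ j, x j a at h5
    simp only [Nat.succ_eq_add_one] at h3
    linarith
  · -- The slots of periods up to `k` are the first `L` ones.
    set X : J → ℝ := fun j => ∑ a with κ a ≤ k, x j a with hX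
    have hXs : ∑ j, X j = ∑ a with κ a ≤ k, y a := by rw [hX, sum_comm]
    have hX0 : ∀ j, 0 ≤ X j := fun j => sum_nonneg fun a _ => hx0 j a
    have hX1 : ∀ j, X j ≤ 1 := fun j => (hx1 j) ▸
      sum_le_sum_of_subset_of_nonneg (filter_subset _ _) fun a _ _ => hx0 j a
    have hsm := sum_smallest_le he (fun i => hd0 (e i)) (X := fun i => X (e i))
      (fun i => hX0 _) (fun i => hX1 _)
    rw [Equiv.sum_comp e X, Equiv.sum_comp e (fun j => X j * d j)] at hsm
    refine le_trans ?_ hsm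
    rw [sum_filter, ← Equiv.sum_comp e, ← sum_filter]
    refine sum_le_sum_of_subset_of_nonneg (fun i hi => ?_) fun i _ _ => hd0 _
    simp only [mem_filter, mem_univ, true_and, Equiv.symm_apply_apply] at hi ⊢
    refine (hs2 i).trans ?_
    rw [hXs, sum_filter, ← Equiv.sum_comp f, ← sum_filter]
    refine sum_le_sum_of_subset_of_nonneg (fun l hl => ?_) fun _ _ _ => hy0 _
    simp only [mem_filter, mem_univ, true_and] at hl ⊢
    exact (hf (show l ≤ s i by rw [Fin.le_def]; omega)).trans hi

/-- `exists_rounding` for finite sets of jobs and slots. -/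
theorem exists_rounding_finset {ι α : Type*} [DecidableEq α] [Nonempty α] (S : Finset ι)
    (A : Finset α) (κ : α → ℤ) (d : ι → ℝ) (hd0 : ∀ j, 0 ≤ d j) (x : ι → α → ℝ)
    (hx0 : ∀ j ∈ S, ∀ a ∈ A, 0 ≤ x j a) (hx1 : ∀ j ∈ S, ∑ a ∈ A, x j a = 1) :
    ∃ g : ι → α, (∀ j ∈ S, g j ∈ A) ∧
      (∀ a ∈ A, ((S.filter fun j => g j = a).card : ℝ) < ∑ j ∈ S, x j a + 1) ∧
      ∀ k, ∑ j ∈ S with κ (g j) ≤ k, d j ≤ ∑ j ∈ S, (∑ a ∈ A with κ a ≤ k, x j a) * d j := by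
  classical
  obtain ⟨g, hg1, hg2⟩ := exists_rounding (J := S) (A := A) (fun a => κ a) (fun j => d j)
    (fun j => hd0 j) (fun j a => x j a) (fun j a => hx0 j j.2 a a.2)
    (fun j => by rw [sum_coe_sort A (fun a => x j a)]; exact hx1 j j.2)
  set G : ι → α := fun j => if h : j ∈ S then (g ⟨j, h⟩ : α) else Classical.arbitrary α with hG
  have hGg : ∀ j : S, G j = g j := fun j => by simp [hG]
  refine ⟨G, fun j hj => ?_, fun a ha => ?_, fun k => ?_⟩
  · rw [show G j = g ⟨j, hj⟩ from hGg ⟨j, hj⟩]; exact (g ⟨j, hj⟩).2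
  · have h := hg1 ⟨a, ha⟩
    rw [sum_coe_sort S (fun j => x j a)] at h
    convert h using 2
    rw [card_filter, card_filter, ← sum_coe_sort S]
    refine sum_congr rfl fun j _ => ?_
    simp only [hGg, Subtype.ext_iff]
  · have h := hg2 k
    have h' := sum_coe_sort S fun j => (∑ a : {a // a ∈ A} with κ a.1 ≤ k, x j a.1) * d j
    rw [sum_filter, h'] at h
    rw [sum_filter, ← sum_coe_sort S]
    simp only [hGg]
    refine h.trans (le_of_eq (sum_congr rfl fun j _ => ?_))
    rw [sum_filter, sum_coe_sort A (fun a => if κ a ≤ k then x j a else 0), sum_filter]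

/-! ### Distributing jobs evenly -/

/-- Greedy load balancing: items of size at most `P` can be put into `Z` bins such that no bin
exceeds the average load by more than `P`. -/
theorem exists_balanced {ι : Type*} (S : Finset ι) (p : ι → ℝ) {P : ℝ} (hP : 0 ≤ P)
    (hp : ∀ j ∈ S, 0 ≤ p j ∧ p j ≤ P) {Z : ℕ} (hZ : 0 < Z) :
    ∃ f : ι → Fin Z, ∀ i, ∑ j ∈ S with f j = i, p j ≤ (∑ j ∈ S, p j) / Z + P := by
  classical
  have : NeZero Z := ⟨hZ.ne'⟩
  have hZ' : (0 : ℝ) < Z := by exact_mod_cast hZ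
  induction S using Finset.induction_on with
  | empty => exact ⟨fun _ => 0, fun i => by simpa using hP⟩
  | insert a S ha ih =>
    obtain ⟨f, hf⟩ := ih fun j hj => hp j (mem_insert_of_mem hj)
    obtain ⟨i₀, -, hi₀⟩ := exists_min_image univ (fun i => ∑ j ∈ S with f j = i, p j)
      univ_nonempty
    have havg : ∑ j ∈ S with f j = i₀, p j ≤ (∑ j ∈ S, p j) / Z := by
      rw [le_div_iff₀ hZ', ← sum_fiberwise S f, mul_comm]
      calc (Z : ℝ) * _ = ∑ _i : Fin Z, ∑ j ∈ S with f j = i₀, p j := by simp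
        _ ≤ _ := sum_le_sum fun i hi => hi₀ i hi
    have hpa := hp a (mem_insert_self _ _)
    have hS : (∑ j ∈ S, p j) / Z ≤ (∑ j ∈ insert a S, p j) / Z := by
      rw [sum_insert ha]; gcongr; linarith
    refine ⟨Function.update f a i₀, fun i => ?_⟩
    have hcongr : ∑ j ∈ S with Function.update f a i₀ j = i, p j = ∑ j ∈ S with f j = i, p j := by
      refine sum_congr (filter_congr fun j hj => ?_) fun _ _ => rfl
      rw [Function.update_of_ne (by rintro rfl; exact ha hj)]
    rw [filter_insert, Function.update_self]
    split_ifs with h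
    · rw [sum_insert (by simp [ha]), hcongr, ← h]
      linarith
    · rw [hcongr]
      linarith [hf i]

/-- At most `Z * B` items can be put into `Z` bins with at most `B` items per bin. -/
theorem exists_fibers_card_le {ι : Type*} (S : Finset ι) {Z B : ℕ} (hZ : 0 < Z)
    (h : S.card ≤ Z * B) : ∃ f : ι → Fin Z, ∀ i, (S.filter fun j => f j = i).card ≤ B := by
  classical
  obtain ⟨F⟩ : Nonempty (S ↪ Fin Z × Fin B) :=
    Function.Embedding.nonempty_of_card_le (by simpa using h)
  refine ⟨fun j => if hj : j ∈ S then (F ⟨j, hj⟩).1 else ⟨0, hZ⟩, fun i => ?_⟩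
  by_contra! hlt
  have hlt' : (univ : Finset (Fin B)).card <
      (S.filter fun j => (if hj : j ∈ S then (F ⟨j, hj⟩).1 else ⟨0, hZ⟩) = i).attach.card := by
    simpa using hlt
  obtain ⟨a, -, b, -, hab, h2⟩ := exists_ne_map_eq_of_card_lt_of_maps_to hlt'
    (f := fun j => (F ⟨j.1, (mem_filter.1 j.2).1⟩).2) (fun _ _ => mem_univ _)
  refine hab ?_
  have ha := (mem_filter.1 a.2).2
  have hb := (mem_filter.1 b.2).2
  rw [dif_pos (mem_filter.1 a.2).1] at ha
  rw [dif_pos (mem_filter.1 b.2).1] at hb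
  have := F.injective (Prod.ext (ha.trans hb.symm) h2)
  exact Subtype.ext (congrArg (fun s : S => (s : ι)) this)

/-- If every fiber of `f` is at most as large as the fiber of `g` over the same point, then `f`
factors through `g` by an injective map. -/
theorem exists_injective_lift {α β γ : Type*} [Fintype α] [Fintype β] [DecidableEq γ] (f : α → γ)
    (g : β → γ)
    (h : ∀ a, (univ.filter fun a' => f a' = f a).card ≤ (univ.filter fun b => g b = f a).card) :
    ∃ F : α → β, Function.Injective F ∧ ∀ a, g (F a) = f a := by
  have hemb : ∀ c, Nonempty ({a // f a = c} ↪ {b // g b = c}) := by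
    intro c
    refine Function.Embedding.nonempty_of_card_le ?_
    by_cases hc : ∃ a, f a = c
    · obtain ⟨a, rfl⟩ := hc
      rw [Fintype.card_subtype, Fintype.card_subtype]
      exact h a
    · have : IsEmpty {a // f a = c} := ⟨fun a => hc ⟨a.1, a.2⟩⟩
      rw [Fintype.card_eq_zero]
      exact Nat.zero_le _
  have E := fun c => (hemb c).some
  refine ⟨fun a => E (f a) ⟨a, rfl⟩, fun a b hab => ?_, fun a => (E (f a) ⟨a, rfl⟩).2⟩
  have hfab : f b = f a := by
    rw [← (E (f a) ⟨a, rfl⟩).2, ← (E (f b) ⟨b, rfl⟩).2]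
    exact congrArg g hab.symm
  have aux : ∀ (c : γ) (hc : f b = c), (E (f b) ⟨b, rfl⟩ : β) = E c ⟨b, hc⟩ := by
    rintro _ rfl
    rfl
  have := (E (f a)).injective (Subtype.ext (hab.trans (aux _ hfab)))
  exact congrArg Subtype.val this

/-! ### Schedules from release times -/

/-- The right-justified schedule: if on every machine `i` the jobs released at or after any release
time fit between this time and the deadline `G i`, then processing the jobs in the order of their
release times, without idle time and up to the deadline, respects all release times. -/
theorem exists_schedule (I : Instance) (μ : Fin I.n → Fin I.m) (r : Fin I.n → ℝ) (G : Fin I.m → ℝ)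
    (h : ∀ j, r j + ∑ j' with μ j' = μ j ∧ r j ≤ r j', I.p j' / I.s (μ j) ≤ G (μ j)) :
    ∃ σ : Schedule I, σ.machine = μ ∧ (∀ j, r j ≤ σ.start j) ∧
      (∀ j, σ.completion j ≤ G (μ j)) ∧
      ∀ j j', j ≠ j' → σ.machine j = σ.machine j' →
        σ.completion j ≤ σ.start j' ∨ σ.completion j' ≤ σ.start j := by
  -- Jobs are ordered by release time, ties are broken by index.
  set ℓ : Fin I.n → ℝ ×ₗ Fin I.n := fun j => toLex (r j, j) with hℓ
  have hinj : Function.Injective ℓ := fun a b hab => (Prod.ext_iff.1 (toLex.injective hab)).2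
  set t : Fin I.n → ℝ := fun j => I.p j / I.s (μ j) with ht
  have ht0 : ∀ j, 0 ≤ t j := fun j => div_nonneg (I.p_pos j).le (I.s_pos _).le
  set tail : Fin I.n → ℝ := fun j => ∑ j' with μ j' = μ j ∧ ℓ j ≤ ℓ j', t j' with htail
  have hstep : ∀ j j', μ j = μ j' → ℓ j < ℓ j' → tail j' + t j ≤ tail j := by
    intro j j' hm hlt
    have hnot : j ∉ univ.filter (fun i => μ i = μ j' ∧ ℓ j' ≤ ℓ i) := by
      simp only [mem_filter, mem_univ, true_and, not_and, not_le]
      exact fun _ => hlt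
    rw [add_comm, htail]
    simp only
    rw [← sum_insert hnot]
    refine sum_le_sum_of_subset_of_nonneg (fun i hi => ?_) fun _ _ _ => ht0 _
    simp only [mem_insert, mem_filter, mem_univ, true_and] at hi ⊢
    rcases hi with rfl | ⟨h1, h2⟩
    · exact ⟨rfl, le_rfl⟩
    · exact ⟨h1.trans hm.symm, hlt.le.trans h2⟩
  refine ⟨⟨μ, fun j => G (μ j) - tail j⟩, rfl, fun j => ?_, fun j => ?_, fun j j' hne hm => ?_⟩
  · have h1 : tail j ≤ ∑ j' with μ j' = μ j ∧ r j ≤ r j', I.p j' / I.s (μ j) := by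
      have : ∀ j' ∈ univ.filter (fun j' => μ j' = μ j ∧ r j ≤ r j'),
          I.p j' / I.s (μ j) = t j' := fun j' hj' => by
        rw [ht]; simp only; rw [(mem_filter.1 hj').2.1]
      rw [sum_congr rfl this]
      refine sum_le_sum_of_subset_of_nonneg (fun i hi => ?_) fun _ _ _ => ht0 _
      simp only [mem_filter, mem_univ, true_and] at hi ⊢
      refine ⟨hi.1, ?_⟩
      rcases Prod.Lex.le_iff.1 hi.2 with h | h
      · exact h.le
      · exact h.1.le
    have := h j
    simp only
    linarith
  · have : t j ≤ tail j := single_le_sum (f := t) (fun i _ => ht0 i) (by simp)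
    simp only [Schedule.completion]
    change G (μ j) - tail j + t j ≤ _
    linarith
  · simp only [Schedule.completion] at hm ⊢
    change G (μ j) - tail j + t j ≤ G (μ j') - tail j' ∨
      G (μ j') - tail j' + t j' ≤ G (μ j) - tail j
    rw [hm]
    rcases lt_or_gt_of_ne (fun h => hne (hinj h)) with hlt | hlt
    · left; linarith [hstep j j' hm hlt]
    · right; linarith [hstep j' j hm.symm hlt]

/-! ### Powers of `1 + ε` -/

theorem le_half_of_integral {ε : ℝ} (hε : 0 < ε) (hε1 : ε < 1) (hN : ∃ N : ℕ, 1 / ε = N) :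
    ε ≤ 1 / 2 := by
  obtain ⟨N, hN⟩ := hN
  have h1 : 1 < (N : ℝ) := by rw [← hN, lt_div_iff₀ hε]; linarith
  have h2 : (2 : ℝ) ≤ N := by
    have : 1 < N := by exact_mod_cast h1
    exact_mod_cast this
  rw [← hN, le_div_iff₀ hε] at h2
  linarith

section Powers

variable {ε : ℝ} (hε : 0 < ε)
include hε

theorem IsPow.pos {x : ℝ} (hx : IsPow ε x) : 0 < x := by
  obtain ⟨a, rfl⟩ := hx
  positivity

theorem logb_zpow_base (a : ℤ) : Real.logb (1 + ε) ((1 + ε) ^ a) = a := by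
  rw [← Real.rpow_intCast, Real.logb_rpow (by linarith) (by linarith)]

theorem logb_pow_mul {x : ℝ} (hx : 0 < x) (a : ℤ) :
    Real.logb (1 + ε) (x * (1 + ε) ^ a) = Real.logb (1 + ε) x + a := by
  rw [Real.logb_mul hx.ne' (by positivity), logb_zpow_base hε]

theorem zpow_floor_logb_le {x : ℝ} (hx : 0 < x) : (1 + ε) ^ ⌊Real.logb (1 + ε) x⌋ ≤ x := by
  rw [← Real.rpow_intCast, ← Real.le_logb_iff_rpow_le (by linarith) hx]
  exact Int.floor_le _

theorem le_zpow_ceil_logb {x : ℝ} (hx : 0 < x) : x ≤ (1 + ε) ^ ⌈Real.logb (1 + ε) x⌉ := by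
  rw [← Real.rpow_intCast, ← Real.logb_le_iff_le_rpow (by linarith) hx]
  exact Int.le_ceil _

theorem bigDelta_eq (a : ℤ) : bigDelta ε ((1 + ε) ^ a) = a + 1 := by
  rw [bigDelta, logb_pow_mul hε (by linarith),
    show Real.logb (1 + ε) (1 + ε) = 1 from Real.logb_self_eq_one (by linarith)]
  rw [Int.ceil_add_intCast, Int.ceil_one, add_comm]

theorem smallDelta_eq (a : ℤ) :
    smallDelta ε ((1 + ε) ^ a) = smallDelta ε 1 + a := by
  rw [smallDelta, logb_pow_mul hε (by positivity), Int.ceil_add_intCast, smallDelta, mul_one]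

theorem lam_eq {w : ℝ} (hw : IsPow ε w) : lam ε w = lam ε 1 := by
  obtain ⟨a, rfl⟩ := hw
  have h := bigDelta_eq hε 0
  rw [zpow_zero] at h
  rw [lam, lam, bigDelta_eq hε, smallDelta_eq hε, h]
  congr 1
  ring

theorem lam_cast {w : ℝ} (hw : IsPow ε w) (hε1 : ε < 1) :
    (lam ε w : ℤ) = bigDelta ε w - smallDelta ε w + 1 := by
  obtain ⟨a, rfl⟩ := hw
  rw [lam, Int.toNat_of_nonneg]
  rw [bigDelta_eq hε, smallDelta_eq hε]
  have : smallDelta ε 1 ≤ 0 := by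
    rw [smallDelta, Int.ceil_le, mul_one]
    have : Real.logb (1 + ε) (ε ^ rho) ≤ 0 :=
      Real.logb_nonpos (by linarith) (by positivity) (pow_le_one₀ hε.le hε1.le)
    simpa using this
  omega

/-- Distinct powers of `1 + ε` that are at most `x` are dominated by a geometric series. -/
theorem sum_powers_le (A : Finset ℝ) (hA : ∀ a ∈ A, IsPow ε a) {x : ℝ} (hx : 0 ≤ x)
    (hAx : ∀ a ∈ A, a ≤ x) : ∑ a ∈ A, a ≤ x * ((1 + ε) / ε) := by
  induction A using Finset.induction_on_max generalizing x with
  | empty => simpa using by positivity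
  | insert a A ha ih =>
    have haA : a ∉ A := fun h => lt_irrefl _ (ha a h)
    rw [sum_insert haA]
    have hpow := hA a (mem_insert_self _ _)
    have ha0 := IsPow.pos hε hpow
    have h1 : ∑ b ∈ A, b ≤ a / (1 + ε) * ((1 + ε) / ε) := by
      refine ih (fun b hb => hA b (mem_insert_of_mem hb)) (by positivity) fun b hb => ?_
      obtain ⟨i, hi⟩ := hA b (mem_insert_of_mem hb)
      obtain ⟨l, hl⟩ := hpow
      have hlt := ha b hb
      rw [hi, hl, zpow_lt_zpow_iff_right₀ (by linarith)] at hlt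
      rw [hi, hl, div_eq_mul_inv, ← zpow_sub_one₀ (by positivity), zpow_le_zpow_iff_right₀ (by linarith)]
      omega
    calc a + ∑ b ∈ A, b ≤ a + a / (1 + ε) * ((1 + ε) / ε) := by gcongr
      _ = a * ((1 + ε) / ε) := by field_simp; ring
      _ ≤ x * ((1 + ε) / ε) := by gcongr; exact hAx a (mem_insert_self _ _)

theorem muTilde_le (hε1 : ε ≤ 1 / 2) : (muTilde ε : ℝ) ≤ 1 / ε ^ 2 + 2 := by
  have hL : Real.logb (1 + ε) (1 / ε) ≤ 1 / ε ^ 2 - 1 := by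
    have hlog : 0 < Real.log (1 + ε) := Real.log_pos (by linarith)
    rw [Real.logb, div_le_iff₀ hlog]
    have h1 : Real.log (1 / ε) ≤ 1 / ε - 1 := Real.log_le_sub_one_of_pos (by positivity)
    have h2 : ε / (1 + ε) ≤ Real.log (1 + ε) := by
      have := Real.one_sub_inv_le_log_of_pos (show 0 < 1 + ε by linarith)
      refine le_trans (le_of_eq ?_) this
      field_simp; ring
    have h3 : (0 : ℝ) ≤ 1 / ε ^ 2 - 1 := by
      rw [sub_nonneg, le_div_iff₀ (by positivity)]; nlinarith
    calc Real.log (1 / ε) ≤ 1 / ε - 1 := h1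
      _ = (1 / ε ^ 2 - 1) * (ε / (1 + ε)) := by field_simp; ring
      _ ≤ _ := by gcongr
  have hL0 : 0 ≤ Real.logb (1 + ε) (1 / ε) :=
    Real.logb_nonneg (by linarith) (by rw [le_div_iff₀ hε]; linarith)
  have := Nat.ceil_lt_add_one (show 0 ≤ Real.logb (1 + ε) (1 / ε) + 2 by linarith)
  rw [muTilde]
  linarith

/-- An excess of `ε ^ ρ (3 + 1 / ε) w` in each of the `muTilde ε` periods of a configuration adds up
to at most `ε w`. -/
theorem muTilde_mul_le (hε1 : ε ≤ 1 / 2) :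
    (muTilde ε : ℝ) * (ε ^ rho * (3 + 1 / ε)) ≤ ε := by
  have h1 := muTilde_le hε hε1
  have h2 : ε ^ 6 ≤ (1 / 2) ^ 6 := by gcongr
  calc (muTilde ε : ℝ) * (ε ^ rho * (3 + 1 / ε))
      ≤ (1 / ε ^ 2 + 2) * (ε ^ rho * (3 + 1 / ε)) := by gcongr
    _ = ε * (ε ^ 6 * ((1 + 2 * ε ^ 2) * (3 * ε + 1))) := by rw [rho]; field_simp
    _ ≤ ε * ((1 / 2) ^ 6 * ((1 + 2 * (1 / 2) ^ 2) * (3 * (1 / 2) + 1))) := by gcongr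
    _ ≤ ε * 1 := by gcongr; norm_num
    _ = ε := mul_one ε

end Powers

/-! ### Feasible configurations -/

namespace Config

/-- The processing time of all jobs of period `k`. -/
def content (ε : ℝ) (c : Config) (k : ℤ) : ℝ := c.virtTime ε k + (c.bigList ε k).sum

theorem sum_bigList (ε : ℝ) (c : Config) (k : ℤ) :
    (c.bigList ε k).sum = ∑ r ∈ c.bigIdx ε, c.B k r * c.bigTime ε r := by
  rw [bigList, bigIdx]
  generalize lam ε c.w = l
  induction l with
  | zero => simp
  | succ l ih =>
    rw [List.range_succ, List.flatMap_append, List.sum_append, ih, sum_Icc_succ_top (by omega)]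
    simp

variable {ε : ℝ} (hε : 0 < ε) {c : Config}
include hε

theorem bigTime_pos (r : ℕ) : 0 < c.bigTime ε r := by rw [bigTime]; positivity

theorem sum_bigList_nonneg (k : ℤ) : 0 ≤ (c.bigList ε k).sum := by
  rw [sum_bigList]
  exact sum_nonneg fun r _ => mul_nonneg (Nat.cast_nonneg _) (bigTime_pos hε r).le

theorem virtTime_nonneg (hw : 0 < c.w) (k : ℤ) : 0 ≤ c.virtTime ε k := by
  rw [virtTime]; positivity

theorem content_nonneg (hw : 0 < c.w) (k : ℤ) : 0 ≤ c.content ε k :=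
  add_nonneg (virtTime_nonneg hε hw k) (sum_bigList_nonneg hε k)

theorem le_bigTime (hw : 0 < c.w) {r : ℕ} (hr : r ∈ c.bigIdx ε) :
    ε ^ rho * c.w ≤ c.bigTime ε r := by
  have h1 : 1 ≤ r := (mem_Icc.1 hr).1
  refine (le_zpow_ceil_logb hε (by positivity)).trans ?_
  rw [bigTime, zpow_le_zpow_iff_right₀ (by linarith), smallDelta]
  omega

theorem nuU_zpow (hw : IsPow ε c.w) : (1 + ε) ^ c.nuU ε = (1 + ε) * c.w := by
  obtain ⟨a, ha⟩ := hw
  have : c.nuU ε = a + 1 := by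
    have := bigDelta_eq hε a
    rw [bigDelta, ← ha] at this
    exact this
  rw [this, zpow_add_one₀ (by positivity), ha, mul_comm]

theorem card_periods (hw : IsPow ε c.w) (hε1 : ε < 1) : (c.periods ε).card = muTilde ε := by
  obtain ⟨a, ha⟩ := hw
  have hU : c.nuU ε = a + 1 := by
    have := bigDelta_eq hε a
    rw [bigDelta, ← ha] at this
    exact this
  have hL : c.nuL ε = a - ⌈Real.logb (1 + ε) (1 / ε)⌉ := by
    rw [nuL, ha, logb_pow_mul hε hε, Int.floor_add_intCast, one_div, Real.logb_inv, Int.ceil_neg]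
    ring
  have hnn : 0 ≤ Real.logb (1 + ε) (1 / ε) :=
    Real.logb_nonneg (by linarith) (by rw [le_div_iff₀ hε]; linarith)
  rw [periods, Int.card_Icc, hU, hL, muTilde]
  have h2 : (⌈Real.logb (1 + ε) (1 / ε) + 2⌉₊ : ℤ) = ⌈Real.logb (1 + ε) (1 / ε)⌉ + 2 := by
    rw [Int.natCast_ceil_eq_ceil (by linarith)]
    exact_mod_cast Int.ceil_add_intCast _ 2
  omega

theorem nuL_le_nuU (hw : IsPow ε c.w) (hε1 : ε < 1) : c.nuL ε ≤ c.nuU ε := by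
  have hw0 := IsPow.pos hε hw
  have h1 : (1 + ε) ^ c.nuL ε ≤ (1 + ε) ^ c.nuU ε := by
    refine (zpow_floor_logb_le hε (by positivity)).trans ?_
    rw [nuU_zpow hε hw]
    gcongr
    linarith
  exact (zpow_le_zpow_iff_right₀ (by linarith)).1 h1

/-- The generated schedule ends by `(1 + ε) w`, even where it only waits for a period to start. -/
theorem IsFeasible.finish_le {I : Instance} {Copt : ℝ} (hc : c.IsFeasible ε I Copt) (hε1 : ε < 1)
    (n : ℕ) (hn : c.nuL ε + n ≤ c.nuU ε + 1) : c.finish ε n ≤ (1 + ε) * c.w := by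
  have hle : ∀ k : ℤ, k ≤ c.nuU ε → (1 + ε) ^ k ≤ (1 + ε) * c.w := fun k hk => by
    rw [← nuU_zpow hε hc.load_pow]
    exact zpow_le_zpow_right₀ (by linarith) hk
  induction n with
  | zero => exact hle _ (nuL_le_nuU hε hc.load_pow hε1)
  | succ n ih =>
    have hk : c.nuL ε + (n : ℤ) ∈ c.periods ε := mem_Icc.2 ⟨by omega, by push_cast at hn; omega⟩
    by_cases hemp : c.S (c.nuL ε + n) ≠ 0 ∨ c.bigList ε (c.nuL ε + n) ≠ []
    · have := hc.completed _ hk hemp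
      rwa [periodEnd, bigStart, show (c.nuL ε + (n : ℤ) - c.nuL ε).toNat = n by simp] at this
    · push Not at hemp
      rw [finish, virtTime, hemp.1, hemp.2]
      simp only [Nat.cast_zero, zero_mul, add_zero, List.sum_nil]
      exact max_le (hle _ (mem_Icc.1 hk).2) (ih (by push_cast at hn; omega))

omit hε in
theorem le_finish (i n : ℕ) (hin : i ≤ n) :
    (1 + ε) ^ (c.nuL ε + i) + ∑ l ∈ Ico i (n + 1), c.content ε (c.nuL ε + l) ≤
      c.finish ε (n + 1) := by
  induction n, hin using Nat.le_induction with
  | base =>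
    rw [Nat.Ico_succ_singleton, sum_singleton, finish, content, add_assoc]
    gcongr
    exact le_max_left _ _
  | succ n hin ih =>
    rw [sum_Ico_succ_top (by omega), finish, content, ← add_assoc, ← add_assoc]
    gcongr
    exact ih.trans (le_max_right _ _)

/-- The jobs of the periods from `k` on fit between the start of period `k` and the load bound. -/
theorem IsFeasible.content_le {I : Instance} {Copt : ℝ} (hc : c.IsFeasible ε I Copt) (hε1 : ε < 1)
    {k : ℤ} (hk : k ∈ c.periods ε) :
    (1 + ε) ^ k + ∑ k' ∈ c.periods ε with k ≤ k', c.content ε k' ≤ (1 + ε) * c.w := by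
  obtain ⟨h1, h2⟩ := mem_Icc.1 hk
  obtain ⟨i, hi⟩ := Int.eq_ofNat_of_zero_le (sub_nonneg.2 h1)
  obtain ⟨n, hn⟩ := Int.eq_ofNat_of_zero_le (sub_nonneg.2 (h1.trans h2))
  have key := (le_finish (c := c) i n (by omega)).trans
    (hc.finish_le hε hε1 (n + 1) (by push_cast; omega))
  rw [show c.nuL ε + (i : ℤ) = k by omega] at key
  refine le_trans (le_of_eq ?_) key
  congr 1
  symm
  refine sum_nbij (fun l => c.nuL ε + (l : ℤ)) ?_ ?_ ?_ fun _ _ => rfl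
  · intro l hl
    rw [mem_Ico] at hl
    rw [mem_filter, periods, mem_Icc]
    omega
  · intro a _ b _ h
    simpa using h
  · intro k' hk'
    rw [mem_coe, mem_filter, periods, mem_Icc] at hk'
    exact ⟨(k' - c.nuL ε).toNat, by rw [mem_coe, mem_Ico]; omega, by simp only; omega⟩

theorem IsFeasible.content_le_single {I : Instance} {Copt : ℝ} (hc : c.IsFeasible ε I Copt)
    (hε1 : ε < 1) {k : ℤ} (hk : k ∈ c.periods ε) : c.content ε k ≤ (1 + ε) * c.w := by
  have hw := IsPow.pos hε hc.load_pow
  have h1 := hc.content_le hε hε1 hk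
  have h2 : c.content ε k ≤ ∑ k' ∈ c.periods ε with k ≤ k', c.content ε k' :=
    single_le_sum (f := fun k' => c.content ε k') (fun i _ => content_nonneg hε hw i)
      (by simp [hk])
  have h3 : 0 < (1 + ε) ^ k := by positivity
  linarith

theorem IsFeasible.S_le {I : Instance} {Copt : ℝ} (hc : c.IsFeasible ε I Copt) (hε1 : ε < 1)
    {k : ℤ} (hk : k ∈ c.periods ε) : c.S k ≤ ⌊(1 + ε) / ε ^ rho⌋₊ := by
  have hw := IsPow.pos hε hc.load_pow
  have h := hc.content_le_single hε hε1 hk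
  rw [content, virtTime] at h
  have h2 := sum_bigList_nonneg hε (c := c) k
  rw [Nat.le_floor_iff (by positivity), le_div_iff₀ (by positivity)]
  refine le_of_mul_le_mul_right ?_ hw
  linarith

theorem IsFeasible.B_le {I : Instance} {Copt : ℝ} (hc : c.IsFeasible ε I Copt) (hε1 : ε < 1)
    {k : ℤ} (hk : k ∈ c.periods ε) {r : ℕ} (hr : r ∈ c.bigIdx ε) :
    c.B k r ≤ ⌊(1 + ε) / ε ^ rho⌋₊ := by
  have hw := IsPow.pos hε hc.load_pow
  have h := hc.content_le_single hε hε1 hk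
  have h2 := virtTime_nonneg hε hw k
  rw [content, sum_bigList] at h
  have h3 : c.B k r * c.bigTime ε r ≤ ∑ r ∈ c.bigIdx ε, c.B k r * c.bigTime ε r :=
    single_le_sum (f := fun r => c.B k r * c.bigTime ε r)
      (fun r _ => mul_nonneg (Nat.cast_nonneg _) (bigTime_pos hε r).le) hr
  have h4 : c.B k r * (ε ^ rho * c.w) ≤ c.B k r * c.bigTime ε r := by
    gcongr; exact le_bigTime hε hw hr
  rw [Nat.le_floor_iff (by positivity), le_div_iff₀ (by positivity)]
  refine le_of_mul_le_mul_right ?_ hw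
  linarith

end Config

/-! ### The number of configurations -/

/-- The bound on the number of feasible configurations with given speed and load bound. -/
def configBound (ε : ℝ) : ℝ := ((1 + ε) / ε ^ rho + 1) ^ (muTilde ε * (lam ε 1 + 1))

/-- A feasible configuration with given speed and load bound is determined by the numbers `S k` and
`B k r`, each of which is at most `(1 + ε) / ε ^ ρ`. -/
theorem card_configs_le {ε : ℝ} (hε : 0 < ε) (hε1 : ε < 1) {I : Instance} {Copt : ℝ}
    (C : Finset Config) (hC : ∀ c ∈ C, c.IsFeasible ε I Copt) (s w : ℝ)
    (hsw : ∀ c ∈ C, c.s = s ∧ c.w = w) : (C.card : ℝ) ≤ configBound ε := by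
  rcases C.eq_empty_or_nonempty with rfl | ⟨c₀, hc₀⟩
  · rw [card_empty, Nat.cast_zero, configBound]; positivity
  set M := ⌊(1 + ε) / ε ^ rho⌋₊
  have hper : ∀ c ∈ C, c.periods ε = c₀.periods ε := fun c hc => by
    simp only [Config.periods, Config.nuL, Config.nuU, (hsw c hc).2, (hsw c₀ hc₀).2]
  have hidx : ∀ c ∈ C, c.bigIdx ε = c₀.bigIdx ε := fun c hc => by
    simp only [Config.bigIdx, (hsw c hc).2, (hsw c₀ hc₀).2]
  -- `S k` is stored as the entry with index `0`.
  let D := c₀.periods ε ×ˢ Finset.range (lam ε c₀.w + 1)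
  let T := D.pi fun _ => Finset.range (M + 1)
  let F : Config → (a : ℤ × ℕ) → a ∈ D → ℕ := fun c a _ => if a.2 = 0 then c.S a.1 else c.B a.1 a.2
  have hmaps : Set.MapsTo F C T := by
    intro c hc
    have hcf := hC c hc
    rw [mem_coe, Finset.mem_pi]
    intro a ha
    obtain ⟨h1, h2⟩ := mem_product.1 ha
    rw [← hper c hc] at h1
    rw [mem_range] at h2 ⊢
    simp only [F]
    split_ifs with h0
    · exact Nat.lt_succ_of_le (hcf.S_le hε hε1 h1)
    · refine Nat.lt_succ_of_le (hcf.B_le hε hε1 h1 ?_)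
      rw [hidx c hc, Config.bigIdx, mem_Icc]
      omega
  have hinj : Set.InjOn F C := by
    intro c hc c' hc' h
    have hv : ∀ a (ha : a ∈ D), F c a ha = F c' a ha := fun a ha => by rw [h]
    have hS : c.S = c'.S := by
      funext k
      by_cases hk : k ∈ c₀.periods ε
      · simpa [F] using hv (k, 0) (mem_product.2 ⟨hk, by simp⟩)
      · rw [(hC c hc).S_support k (by rwa [hper c hc]),
          (hC c' hc').S_support k (by rwa [hper c' hc'])]
    have hB : c.B = c'.B := by
      funext k r
      by_cases hk : k ∈ c₀.periods ε ∧ r ∈ c₀.bigIdx ε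
      · have hr := mem_Icc.1 hk.2
        have := hv (k, r) (mem_product.2 ⟨hk.1, by rw [mem_range]; omega⟩)
        simpa [F, show r ≠ 0 by omega] using this
      · rw [(hC c hc).B_support k r (by rwa [hper c hc, hidx c hc]),
          (hC c' hc').B_support k r (by rwa [hper c' hc', hidx c' hc'])]
    cases c; cases c'
    have h1 := hsw _ hc
    have h2 := hsw _ hc'
    simp only at h1 h2 hS hB
    simp only [h1, h2, hS, hB]
  have hcard := card_le_card_of_injOn F hmaps hinj
  have hw := (hC c₀ hc₀).load_pow
  rw [card_pi, prod_const, card_product, Finset.card_range, Finset.card_range,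
    Config.card_periods hε hw hε1, lam_eq hε hw] at hcard
  calc (C.card : ℝ) ≤ ((M + 1 : ℕ) : ℝ) ^ (muTilde ε * (lam ε 1 + 1)) := by exact_mod_cast hcard
    _ ≤ _ := by
      rw [configBound]
      push_cast
      gcongr
      exact Nat.floor_le (by positivity)

/-- The total capacity of one machine for each configuration that is slow or has a small load bound
is negligible. Both families are bounded by a product of two geometric series. -/
theorem sum_slow_or_light_le {ε : ℝ} (hε : 0 < ε) (hε1 : ε < 1) {I : Instance}
    (hI : I.IsRounded ε) {Copt sopt : ℝ} (hg : IsGuess ε I Copt sopt)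
    (C : Finset Config) (hC : ∀ c ∈ C, c.IsFeasible ε I Copt)
    (hsmall : ∀ c ∈ C, c.s < kappa ε sopt ∨ c.w < kappa ε sopt * Copt) :
    ∑ c ∈ C, c.s * ((1 + 2 * ε) * c.w) ≤ 2 * ε * Copt * sopt := by
  classical
  have hspow : ∀ c ∈ C, IsPow ε c.s ∧ c.s ≤ 1 := fun c hc => by
    obtain ⟨i, hi⟩ := (hC c hc).speed
    exact hi ▸ ⟨hI.s_pow i, I.s_le_one i⟩
  have hs0 : ∀ c ∈ C, 0 < c.s := fun c hc => IsPow.pos hε (hspow c hc).1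
  have hw0 : ∀ c ∈ C, 0 < c.w := fun c hc => IsPow.pos hε (hC c hc).load_pow
  have hC0 := IsPow.pos hε hg.Copt_pow
  have hso : 0 < sopt := by
    obtain ⟨i, hi⟩ := hg.sopt_speed
    exact hi ▸ I.s_pos i
  have hN : 0 < configBound ε := by rw [configBound]; positivity
  have hκ : kappa ε sopt = ε * sopt / ((1 + 2 * ε) * configBound ε * ((1 + ε) ^ 3 / ε ^ 2)) := rfl
  have hκ0 : 0 < kappa ε sopt := by rw [hκ]; positivity
  -- A set of configurations with speed bound `a` and load bound `b`.
  have box : ∀ D ⊆ C, ∀ a b : ℝ, 0 ≤ a → 0 ≤ b → (∀ c ∈ D, c.s ≤ a ∧ c.w ≤ b) →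
      ∑ c ∈ D, c.s * c.w ≤ configBound ε * (a * ((1 + ε) / ε) * (b * ((1 + ε) / ε))) := by
    intro D hD a b ha hb hab
    set P := D.image Config.s ×ˢ D.image Config.w
    have hmaps : ∀ c ∈ D, (c.s, c.w) ∈ P := fun c hc =>
      mem_product.2 ⟨mem_image_of_mem _ hc, mem_image_of_mem _ hc⟩
    have hS : ∑ s ∈ D.image Config.s, s ≤ a * ((1 + ε) / ε) := by
      refine sum_powers_le hε _ (fun s hs => ?_) ha fun s hs => ?_ <;>
      obtain ⟨c, hc, rfl⟩ := mem_image.1 hs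
      · exact (hspow c (hD hc)).1
      · exact (hab c hc).1
    have hW : ∑ w ∈ D.image Config.w, w ≤ b * ((1 + ε) / ε) := by
      refine sum_powers_le hε _ (fun s hs => ?_) hb fun s hs => ?_ <;>
      obtain ⟨c, hc, rfl⟩ := mem_image.1 hs
      · exact (hC c (hD hc)).load_pow
      · exact (hab c hc).2
    have hSnn : 0 ≤ ∑ s ∈ D.image Config.s, s := sum_nonneg fun s hs => by
      obtain ⟨c, hc, rfl⟩ := mem_image.1 hs
      exact (hs0 c (hD hc)).le
    have hWnn : 0 ≤ ∑ w ∈ D.image Config.w, w := sum_nonneg fun s hs => by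
      obtain ⟨c, hc, rfl⟩ := mem_image.1 hs
      exact (hw0 c (hD hc)).le
    calc ∑ c ∈ D, c.s * c.w
        = ∑ p ∈ P, ∑ c ∈ D with (c.s, c.w) = p, c.s * c.w := (sum_fiberwise_of_maps_to hmaps _).symm
      _ ≤ ∑ p ∈ P, configBound ε * (p.1 * p.2) := by
          refine sum_le_sum fun p hp => ?_
          have heq : ∀ c ∈ D.filter (fun c => (c.s, c.w) = p), c.s * c.w = p.1 * p.2 :=
            fun c hc => by rw [← (mem_filter.1 hc).2]
          rw [sum_congr rfl heq, sum_const, nsmul_eq_mul]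
          obtain ⟨h1, h2⟩ := mem_product.1 hp
          obtain ⟨c, hc, hcs⟩ := mem_image.1 h1
          obtain ⟨c', hc', hcw⟩ := mem_image.1 h2
          have hp1 : 0 < p.1 := hcs ▸ hs0 c (hD hc)
          have hp2 : 0 < p.2 := hcw ▸ hw0 c' (hD hc')
          gcongr
          refine card_configs_le hε hε1 _ (fun c hc => hC c (hD (mem_filter.1 hc).1)) p.1 p.2
            fun c hc => ?_
          rw [← (mem_filter.1 hc).2]
          exact ⟨rfl, rfl⟩
      _ = configBound ε * ((∑ s ∈ D.image Config.s, s) * ∑ w ∈ D.image Config.w, w) := by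
          rw [← mul_sum, sum_product, sum_mul_sum]
      _ ≤ _ := by gcongr
  have h1 := box (C.filter fun c => c.s < kappa ε sopt) (filter_subset _ _) (kappa ε sopt)
    ((1 + ε) * Copt) hκ0.le (by positivity) fun c hc =>
      ⟨(mem_filter.1 hc).2.le, (hC c (mem_filter.1 hc).1).load_le⟩
  have h2 := box (C.filter fun c => ¬ c.s < kappa ε sopt) (filter_subset _ _) 1
    (kappa ε sopt * Copt) zero_le_one (by positivity) fun c hc =>
      ⟨(hspow c (mem_filter.1 hc).1).2,
        ((hsmall c (mem_filter.1 hc).1).resolve_left (mem_filter.1 hc).2).le⟩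
  have h3 : 1 * ((1 + ε) / ε) * (kappa ε sopt * Copt * ((1 + ε) / ε)) ≤
      kappa ε sopt * ((1 + ε) / ε) * ((1 + ε) * Copt * ((1 + ε) / ε)) := by
    have : 0 ≤ ε * (kappa ε sopt * ((1 + ε) / ε) * (Copt * ((1 + ε) / ε))) := by positivity
    linarith
  have h4 : ∑ c ∈ C, c.s * c.w ≤
      configBound ε * (2 * (kappa ε sopt * ((1 + ε) / ε) * ((1 + ε) * Copt * ((1 + ε) / ε)))) := by
    rw [← sum_filter_add_sum_filter_not C fun c => c.s < kappa ε sopt]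
    have := mul_le_mul_of_nonneg_left h3 hN.le
    linarith
  calc ∑ c ∈ C, c.s * ((1 + 2 * ε) * c.w) = (1 + 2 * ε) * ∑ c ∈ C, c.s * c.w := by
        rw [mul_sum]; exact sum_congr rfl fun _ _ => by ring
    _ ≤ (1 + 2 * ε) * _ := mul_le_mul_of_nonneg_left h4 (by positivity)
    _ = 2 * ε * Copt * sopt := by rw [hκ]; field_simp

/-! ### Rounding a solution of the MILP -/

section Rounding

variable {ε : ℝ} {I : Instance} {Copt sopt : ℝ} {C : Finset Config}
  {x : Fin I.n → ℤ → Config → ℝ} {z : Config → ℝ}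

theorem IsMILPSolution.x_nonneg (hsol : IsMILPSolution ε I Copt sopt C x z) (j : Fin I.n) (k : ℤ)
    {c : Config} (hc : c ∈ C) : 0 ≤ x j k c := by
  by_cases hk : k ∈ universalPeriods ε I Copt
  · exact (hsol.x_bounds c hc k hk j).1
  · exact (hsol.x_support j c hc k hk).ge

open scoped Classical in
/-- The integral assignment of jobs to periods and configurations. Rounding is done separately for
each job size, and the resource constraints of the size classes add up. -/
theorem IsMILPSolution.exists_integral (hsol : IsMILPSolution ε I Copt sopt C x z) :
    ∃ (κ : Fin I.n → ℤ) (γ : Fin I.n → Config),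
      (∀ j, γ j ∈ C ∧ κ j ∈ (γ j).periods ε ∧ κ j ∈ universalPeriods ε I Copt ∧
        ¬ IsHuge ε (I.p j) (γ j).s (γ j).w) ∧
      (∀ k ∈ universalPeriods ε I Copt, ∑ j with κ j ≤ k, I.d j ≤
        ∑ k' ∈ universalPeriods ε I Copt with k' ≤ k, supply ε I k') ∧
      ∀ (p : ℝ) (k : ℤ), ∀ c ∈ C, ((univ.filter fun j => (κ j = k ∧ γ j = c) ∧ I.p j = p).card : ℝ) <
        ∑ j with I.p j = p, x j k c + 1 := by
  classical
  set K := universalPeriods ε I Copt with hK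
  have : Nonempty (ℤ × Config) := ⟨(0, ⟨0, 0, fun _ _ => 0, fun _ => 0⟩)⟩
  set A : ℝ → Finset (ℤ × Config) := fun p =>
    (K ×ˢ C).filter fun a => ¬ IsHuge ε p a.2.s a.2.w ∧ a.1 ∈ a.2.periods ε with hA
  have hAC : ∀ {p a}, a ∈ A p → a.2 ∈ C := fun ha => (mem_product.1 (mem_filter.1 ha).1).2
  have hone : ∀ j, ∑ a ∈ A (I.p j), x j a.1 a.2 = 1 := by
    intro j
    rw [← hsol.assigned j, sum_filter, sum_product_right, sum_filter]
    refine sum_congr rfl fun c hc => ?_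
    simp only
    by_cases hh : IsHuge ε (I.p j) c.s c.w
    · simp [hh]
    · simp only [hh, not_false_eq_true, true_and, if_true]
      rw [← sum_filter, filter_mem_eq_inter, inter_comm]
      refine sum_subset inter_subset_left fun k hk hk' => hsol.x_support j c hc k fun h => ?_
      exact hk' (mem_inter.2 ⟨hk, h⟩)
  have hround := fun p => exists_rounding_finset (univ.filter fun j => I.p j = p) (A p) Prod.fst I.d
    I.d_nonneg (fun j a => x j a.1 a.2) (fun j _ a ha => hsol.x_nonneg j a.1 (hAC ha))
    (fun j hj => by rw [← (mem_filter.1 hj).2]; exact hone j)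
  choose g hgA hgcard hgres using hround
  refine ⟨fun j => (g (I.p j) j).1, fun j => (g (I.p j) j).2, fun j => ?_, fun k hk => ?_,
    fun p k c hc => ?_⟩
  · have := hgA (I.p j) j (by simp)
    have h2 := (mem_filter.1 this)
    have h3 := mem_product.1 h2.1
    exact ⟨h3.2, h2.2.2, h3.1, h2.2.1⟩
  · refine le_trans ?_ (hsol.resource k hk)
    have hclass : ∀ j ∈ (univ : Finset (Fin I.n)), I.p j ∈ univ.image I.p :=
      fun j hj => mem_image_of_mem _ hj
    calc ∑ j with (g (I.p j) j).1 ≤ k, I.d j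
        = ∑ p ∈ univ.image I.p, ∑ j ∈ univ.filter (fun j => I.p j = p) with (g p j).1 ≤ k, I.d j := by
          rw [sum_filter, ← sum_fiberwise_of_maps_to hclass]
          refine sum_congr rfl fun p _ => ?_
          rw [sum_filter (fun j => (g p j).1 ≤ k)]
          exact sum_congr rfl fun j hj => by rw [(mem_filter.1 hj).2]
      _ ≤ ∑ p ∈ univ.image I.p, ∑ j with I.p j = p,
            (∑ a ∈ A (I.p j) with a.1 ≤ k, x j a.1 a.2) * I.d j := by
          refine sum_le_sum fun p _ => (hgres p k).trans (le_of_eq ?_)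
          exact sum_congr rfl fun j hj => by rw [(mem_filter.1 hj).2]
      _ = ∑ j, (∑ a ∈ A (I.p j) with a.1 ≤ k, x j a.1 a.2) * I.d j :=
          sum_fiberwise_of_maps_to hclass _
      _ ≤ ∑ j, (∑ a ∈ K.filter (fun k' => k' ≤ k) ×ˢ C, x j a.1 a.2) * I.d j := by
          refine sum_le_sum fun j _ => mul_le_mul_of_nonneg_right ?_ (I.d_nonneg j)
          refine sum_le_sum_of_subset_of_nonneg (fun a ha => ?_) fun a ha _ =>
            hsol.x_nonneg j a.1 (mem_product.1 ha).2
          obtain ⟨h1, h2⟩ := mem_filter.1 ha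
          have h3 := mem_product.1 (mem_filter.1 h1).1
          exact mem_product.2 ⟨mem_filter.2 ⟨h3.1, h2⟩, h3.2⟩
      _ = _ := by
          simp only [sum_mul]
          rw [sum_comm, sum_product_right]
  · by_cases ha : (k, c) ∈ A p
    · refine lt_of_le_of_lt ?_ (hgcard p (k, c) ha)
      refine Nat.cast_le.2 (card_le_card fun j hj => ?_)
      obtain ⟨⟨h1, h2⟩, h3⟩ := (mem_filter.1 hj).2
      beta_reduce at h1 h2
      rw [h3] at h1 h2
      rw [filter_filter, mem_filter]
      exact ⟨mem_univ _, h3, Prod.ext h1 h2⟩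
    · have hemp : (univ.filter fun j => ((g (I.p j) j).1 = k ∧ (g (I.p j) j).2 = c) ∧ I.p j = p) =
          ∅ := by
        refine filter_eq_empty_iff.2 fun j _ hj => ha ?_
        obtain ⟨⟨h1, h2⟩, h3⟩ := hj
        have := hgA p j (by simp [h3])
        rw [h3] at h1 h2
        rwa [show (k, c) = g p j from (Prod.ext h1 h2).symm]
      rw [hemp, card_empty, Nat.cast_zero]
      have : 0 ≤ ∑ j with I.p j = p, x j k c := sum_nonneg fun j _ => hsol.x_nonneg j k hc
      linarith

theorem exists_bigTime_eq (hε : 0 < ε) (hε1 : ε < 1) (hI : I.IsRounded ε) {c : Config}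
    (hc : c.IsFeasible ε I Copt) {j : Fin I.n} (hj : ¬ IsHuge ε (I.p j) c.s c.w)
    (hj' : ¬ IsSmall ε (I.p j) c.s c.w) :
    ∃ r ∈ c.bigIdx ε, IsBig ε (I.p j) c.s c.w ∧ I.p j / c.s = c.bigTime ε r := by
  have hw := IsPow.pos hε hc.load_pow
  rw [IsHuge, not_lt] at hj
  rw [IsSmall, not_lt] at hj'
  obtain ⟨i, hi⟩ := hc.speed
  obtain ⟨a, ha⟩ := hI.p_pow j
  obtain ⟨b, hb⟩ := hI.s_pow i
  have hq : I.p j / c.s = (1 + ε) ^ (a - b) := by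
    rw [← hi, ha, hb, zpow_sub₀ (by positivity)]
  have h1 : smallDelta ε c.w ≤ a - b := by
    rw [smallDelta, Int.ceil_le, ← logb_zpow_base hε (a - b), ← hq]
    exact Real.logb_le_logb_of_le (by linarith) (by positivity) hj'
  have h2 : a - b ≤ bigDelta ε c.w := by
    rw [bigDelta, ← Int.cast_le (R := ℝ), ← logb_zpow_base hε (a - b), ← hq]
    refine (Real.logb_le_logb_of_le (by linarith) ?_ hj).trans (Int.le_ceil _)
    rw [hq]; positivity
  have h3 := lam_cast hε hc.load_pow hε1
  refine ⟨(a - b - smallDelta ε c.w + 1).toNat, ?_, ⟨hj', hj⟩, ?_⟩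
  · rw [Config.bigIdx, mem_Icc]
    omega
  · rw [hq, Config.bigTime]
    congr 1
    omega

/-- The jobs of one period of configuration `c` are distributed to `⌈z c⌉` copies of `c`. Since the
number of jobs of each size has grown by less than one, every copy gets at most its number of big
jobs, and the small jobs exceed their bound by at most one job of each size, a geometric series. -/
theorem IsMILPSolution.exists_copies (hsol : IsMILPSolution ε I Copt sopt C x z) (hε : 0 < ε)
    (hε1 : ε < 1) (hI : I.IsRounded ε) {c : Config} (hcC : c ∈ C) (hc : c.IsFeasible ε I Copt)
    {k : ℤ} (hk : k ∈ c.periods ε) (T : Finset (Fin I.n))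
    (hT : ∀ j ∈ T, ¬ IsHuge ε (I.p j) c.s c.w)
    (hcard : ∀ p, ((T.filter fun j => I.p j = p).card : ℝ) < ∑ j with I.p j = p, x j k c + 1) :
    ∃ f : Fin I.n → ℕ, (∀ j ∈ T, f j < ⌈z c⌉₊) ∧ ∀ i,
      ∑ j ∈ T with f j = i, I.p j / c.s ≤
        c.content ε k + ε ^ rho * (3 + 1 / ε) * c.w := by
  classical
  have hw := IsPow.pos hε hc.load_pow
  have hs : 0 < c.s := by
    obtain ⟨i, hi⟩ := hc.speed
    exact hi ▸ I.s_pos i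
  have hz := hsol.z_nonneg c hcC
  have hx : ∀ j, 0 ≤ x j k c := fun j => hsol.x_nonneg j k hcC
  have hclass : ∀ r ∈ c.bigIdx ε, ∀ j, IsBig ε (I.p j) c.s c.w → I.p j / c.s = c.bigTime ε r →
      ∑ j' with I.p j' = I.p j, x j' k c = z c * c.B k r := by
    intro r hr j hb hj
    rw [← hsol.big_jobs c hcC k hk r hr]
    refine sum_congr (filter_congr fun j' _ => ⟨fun h => by rw [h]; exact ⟨hb, hj⟩, fun h => ?_⟩)
      fun _ _ => rfl
    have := h.2.trans hj.symm
    rwa [div_left_inj' hs.ne'] at this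
  rcases hz.eq_or_lt with hz0 | hzpos
  · have hTemp : T = ∅ := by
      refine eq_empty_of_forall_notMem fun j hj => ?_
      have hpos : 1 ≤ (T.filter fun j' => I.p j' = I.p j).card :=
        card_pos.2 ⟨j, mem_filter.2 ⟨hj, rfl⟩⟩
      have hpos' : (1 : ℝ) ≤ (T.filter fun j' => I.p j' = I.p j).card := by exact_mod_cast hpos
      have h := hcard (I.p j)
      have hzero : ∑ j' with I.p j' = I.p j, x j' k c = 0 := by
        by_cases hsm : IsSmall ε (I.p j) c.s c.w
        · have h1 := hsol.small_jobs c hcC k hk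
          rw [← hz0, zero_mul, zero_mul, zero_mul] at h1
          have h2 := (sum_eq_zero_iff_of_nonneg
            (fun j' _ => mul_nonneg (hx j') (I.p_pos j').le)).1
            (h1.antisymm (sum_nonneg fun j' _ => mul_nonneg (hx j') (I.p_pos j').le))
          refine sum_eq_zero fun j' hj' => ?_
          have h3 := h2 j' (mem_filter.2 ⟨mem_univ _, by rw [(mem_filter.1 hj').2]; exact hsm⟩)
          exact (mul_eq_zero.1 h3).resolve_right (I.p_pos j').ne'
        · obtain ⟨r, hr, hb, hj'⟩ := exists_bigTime_eq hε hε1 hI hc (hT j hj) hsm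
          rw [hclass r hr j hb hj', ← hz0, zero_mul]
      linarith
    subst hTemp
    refine ⟨fun _ => 0, fun j hj => absurd hj (notMem_empty j), fun i => ?_⟩
    have := Config.content_nonneg hε hw k
    rw [filter_empty, sum_empty]
    positivity
  set Z := ⌈z c⌉₊ with hZdef
  have hZ : 0 < Z := Nat.ceil_pos.2 hzpos
  have hZr : (0 : ℝ) < Z := by exact_mod_cast hZ
  have hzZ : z c ≤ Z := Nat.le_ceil _
  -- Big jobs, one processing time after the other.
  have hbig : ∀ r ∈ c.bigIdx ε, ∃ f : Fin I.n → Fin Z, ∀ i,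
      ((T.filter fun j => IsBig ε (I.p j) c.s c.w ∧ I.p j / c.s = c.bigTime ε r).filter
        fun j => f j = i).card ≤ c.B k r := by
    intro r hr
    refine exists_fibers_card_le _ hZ ?_
    set S := T.filter fun j => IsBig ε (I.p j) c.s c.w ∧ I.p j / c.s = c.bigTime ε r with hS
    rcases S.eq_empty_or_nonempty with h | ⟨j, hj⟩
    · rw [h, card_empty]; exact Nat.zero_le _
    obtain ⟨hjT, hb, hj'⟩ := mem_filter.1 hj
    have h1 := hcard (I.p j)
    rw [hclass r hr j hb hj'] at h1
    have h2 : S.card ≤ (T.filter fun j' => I.p j' = I.p j).card := by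
      refine card_le_card fun j' h => ?_
      obtain ⟨h3, -, h4⟩ := mem_filter.1 h
      refine mem_filter.2 ⟨h3, ?_⟩
      have := h4.trans hj'.symm
      rwa [div_left_inj' hs.ne'] at this
    have h3 : (S.card : ℝ) < Z * c.B k r + 1 := by
      have h4 : z c * c.B k r ≤ Z * c.B k r := by gcongr
      have h5 : (S.card : ℝ) ≤ (T.filter fun j' => I.p j' = I.p j).card := by exact_mod_cast h2
      linarith
    have h6 : S.card < Z * c.B k r + 1 := by exact_mod_cast h3
    omega
  have : Nonempty (Fin Z) := ⟨⟨0, hZ⟩⟩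
  choose! fb hfb using hbig
  -- Small jobs.
  set S := T.filter fun j => IsSmall ε (I.p j) c.s c.w with hS
  have hSsm : ∀ j ∈ S, I.p j / c.s < ε ^ rho * c.w := fun j hj => (mem_filter.1 hj).2
  obtain ⟨fs, hfs⟩ := exists_balanced S (fun j => I.p j / c.s) (P := ε ^ rho * c.w)
    (by positivity) (fun j hj => ⟨div_nonneg (I.p_pos j).le hs.le, (hSsm j hj).le⟩) hZ
  have htotal : ∑ j ∈ S, I.p j ≤
      z c * c.s * ((c.S k : ℝ) + 1) * (ε ^ rho * c.w) +
        ε ^ rho * c.w * c.s * ((1 + ε) / ε) := by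
    have hgeo : ∑ p ∈ S.image I.p, p ≤ ε ^ rho * c.w * c.s * ((1 + ε) / ε) := by
      refine sum_powers_le hε _ (fun p hp => ?_) (by positivity) fun p hp => ?_ <;>
      obtain ⟨j, hj, rfl⟩ := mem_image.1 hp
      · exact hI.p_pow j
      · have := hSsm j hj
        rw [div_lt_iff₀ hs] at this
        exact this.le
    have hfrac : ∑ p ∈ S.image I.p, ∑ j with I.p j = p, x j k c * I.p j ≤
        z c * c.s * ((c.S k : ℝ) + 1) * (ε ^ rho * c.w) := by
      refine le_trans ?_ (hsol.small_jobs c hcC k hk)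
      rw [← sum_biUnion]
      · refine sum_le_sum_of_subset_of_nonneg (fun j hj => ?_) fun j _ _ =>
          mul_nonneg (hx j) (I.p_pos j).le
        obtain ⟨p, hp, hj⟩ := mem_biUnion.1 hj
        obtain ⟨j', hj', rfl⟩ := mem_image.1 hp
        refine mem_filter.2 ⟨mem_univ _, ?_⟩
        rw [(mem_filter.1 hj).2]
        exact (mem_filter.1 hj').2
      · intro p _ p' _ hne
        refine disjoint_filter.2 fun j _ h h' => hne (h.symm.trans h')
    rw [← sum_fiberwise_of_maps_to (fun j hj => mem_image_of_mem I.p hj)]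
    calc ∑ p ∈ S.image I.p, ∑ j ∈ S with I.p j = p, I.p j
        ≤ ∑ p ∈ S.image I.p, (∑ j with I.p j = p, x j k c * I.p j + p) := by
          refine sum_le_sum fun p hp => ?_
          obtain ⟨j₀, -, hj₀⟩ := mem_image.1 hp
          have hp0 : 0 < p := hj₀ ▸ I.p_pos j₀
          have h1 : ∑ j ∈ S with I.p j = p, I.p j = (S.filter fun j => I.p j = p).card * p := by
            rw [sum_congr rfl fun j hj => (mem_filter.1 hj).2, sum_const, nsmul_eq_mul]
          have h2 : ∑ j with I.p j = p, x j k c * I.p j = (∑ j with I.p j = p, x j k c) * p := by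
            rw [sum_mul]
            exact sum_congr rfl fun j hj => by rw [(mem_filter.1 hj).2]
          have h3 : ((S.filter fun j => I.p j = p).card : ℝ) ≤
              (T.filter fun j => I.p j = p).card :=
            Nat.cast_le.2 (card_le_card (filter_subset_filter _ (filter_subset _ _)))
          rw [h1, h2, ← add_one_mul]
          gcongr
          exact h3.trans (hcard p).le
      _ ≤ _ := by
          rw [sum_add_distrib]
          gcongr
  have hrr : ∀ j ∈ T \ S, ∃ r ∈ c.bigIdx ε, IsBig ε (I.p j) c.s c.w ∧
      I.p j / c.s = c.bigTime ε r := fun j hj => by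
    obtain ⟨h1, h2⟩ := mem_sdiff.1 hj
    exact exists_bigTime_eq hε hε1 hI hc (hT j h1) fun h => h2 (mem_filter.2 ⟨h1, h⟩)
  choose! rr hrr1 hrr2 hrr3 using hrr
  refine ⟨fun j => if j ∈ S then (fs j : ℕ) else fb (rr j) j, fun j _ => ?_, fun i => ?_⟩
  · simp only
    split_ifs <;> exact Fin.is_lt _
  by_cases hi : i < Z
  swap
  · have hemp : T.filter (fun j => (if j ∈ S then (fs j : ℕ) else fb (rr j) j) = i) = ∅ := by
      refine filter_eq_empty_iff.2 fun j _ h => hi ?_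
      rw [← h]
      split_ifs <;> exact Fin.is_lt _
    have := Config.content_nonneg hε hw k
    rw [hemp, sum_empty]
    positivity
  have hsmallbd : ∑ j ∈ S with fs j = ⟨i, hi⟩, I.p j / c.s ≤
      c.virtTime ε k + ε ^ rho * (3 + 1 / ε) * c.w := by
    refine (hfs ⟨i, hi⟩).trans ?_
    rw [← sum_div]
    have h1 : (∑ j ∈ S, I.p j) / c.s / Z ≤
        ((c.S k : ℝ) + 1) * (ε ^ rho * c.w) + ε ^ rho * c.w * ((1 + ε) / ε) := by
      rw [div_le_iff₀ hZr, div_le_iff₀ hs]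
      refine htotal.trans ?_
      have hZ1 : (1 : ℝ) ≤ Z := by exact_mod_cast hZ
      calc z c * c.s * ((c.S k : ℝ) + 1) * (ε ^ rho * c.w) +
            ε ^ rho * c.w * c.s * ((1 + ε) / ε)
          ≤ Z * c.s * ((c.S k : ℝ) + 1) * (ε ^ rho * c.w) +
            Z * (ε ^ rho * c.w * c.s * ((1 + ε) / ε)) := by
            refine add_le_add (by gcongr) (le_mul_of_one_le_left (by positivity) hZ1)
        _ = _ := by ring
    rw [Config.virtTime]
    have h2 : ε ^ rho * c.w * ((1 + ε) / ε) = ε ^ rho * (1 + 1 / ε) * c.w := by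
      field_simp
      ring
    rw [h2] at h1
    linarith
  have hbigbd : ∑ j ∈ T \ S with fb (rr j) j = ⟨i, hi⟩, I.p j / c.s ≤ (c.bigList ε k).sum := by
    rw [Config.sum_bigList, ← sum_fiberwise_of_maps_to
      (fun j hj => hrr1 j (mem_filter.1 hj).1)]
    refine sum_le_sum fun r hr => ?_
    have h1 : ∀ j ∈ ((T \ S).filter fun j => fb (rr j) j = ⟨i, hi⟩).filter (fun j => rr j = r),
        I.p j / c.s = c.bigTime ε r := fun j hj => by
      obtain ⟨h1, h2⟩ := mem_filter.1 hj
      rw [hrr3 j (mem_filter.1 h1).1, h2]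
    rw [sum_congr rfl h1, sum_const, nsmul_eq_mul]
    have hpos := Config.bigTime_pos hε (c := c) r
    gcongr
    refine le_trans (card_le_card fun j hj => ?_) (hfb r hr ⟨i, hi⟩)
    have h2 := h1 j hj
    obtain ⟨h3, h4⟩ := mem_filter.1 hj
    obtain ⟨h5, h6⟩ := mem_filter.1 h3
    rw [h4] at h6
    exact mem_filter.2 ⟨mem_filter.2 ⟨(mem_sdiff.1 h5).1, hrr2 j h5, h2⟩, h6⟩
  have hsplit : T.filter (fun j => (if j ∈ S then (fs j : ℕ) else fb (rr j) j) = i) ⊆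
      (S.filter fun j => fs j = ⟨i, hi⟩) ∪ (T \ S).filter fun j => fb (rr j) j = ⟨i, hi⟩ := by
    intro j hj
    obtain ⟨h1, h2⟩ := mem_filter.1 hj
    rw [mem_union]
    split_ifs at h2 with h
    · exact Or.inl (mem_filter.2 ⟨h, Fin.ext h2⟩)
    · exact Or.inr (mem_filter.2 ⟨mem_sdiff.2 ⟨h1, h⟩, Fin.ext h2⟩)
  have hnn : ∀ j, 0 ≤ I.p j / c.s := fun j => div_nonneg (I.p_pos j).le hs.le
  calc _ ≤ ∑ j ∈ (S.filter fun j => fs j = ⟨i, hi⟩) ∪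
          (T \ S).filter fun j => fb (rr j) j = ⟨i, hi⟩, I.p j / c.s :=
        sum_le_sum_of_subset_of_nonneg hsplit fun j _ _ => hnn j
    _ ≤ ∑ j ∈ S with fs j = ⟨i, hi⟩, I.p j / c.s +
          ∑ j ∈ T \ S with fb (rr j) j = ⟨i, hi⟩, I.p j / c.s := by
        rw [← sum_union_inter]
        exact le_add_of_nonneg_right (sum_nonneg fun j _ => hnn j)
    _ ≤ _ := by rw [Config.content]; linarith

open scoped Classical in
/-- The outcome of rounding: job `j` is started in period `κ j` on copy `ι j` of the configuration
`γ j`, where configuration `c` has `⌈z c⌉` copies, the total requirement of the jobs of any initial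
segment of periods is available, and the jobs of any final segment of periods on one copy fit
between the start of that segment and `(1 + 2 ε) w`. -/
structure IsIntegral (ε : ℝ) (I : Instance) (Copt : ℝ) (C : Finset Config) (z : Config → ℝ)
    (κ : Fin I.n → ℤ) (γ : Fin I.n → Config) (ι : Fin I.n → ℕ) : Prop where
  mem : ∀ j, γ j ∈ C
  period : ∀ j, κ j ∈ universalPeriods ε I Copt
  copy_lt : ∀ j, ι j < ⌈z (γ j)⌉₊
  resource : ∀ k ∈ universalPeriods ε I Copt, ∑ j with κ j ≤ k, I.d j ≤
    ∑ k' ∈ universalPeriods ε I Copt with k' ≤ k, supply ε I k'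
  load : ∀ c ∈ C, ∀ i k, (1 + ε) ^ k +
    ∑ j ∈ univ.filter (fun j => (γ j = c ∧ ι j = i) ∧ k ≤ κ j), I.p j / c.s ≤
      max ((1 + 2 * ε) * c.w) ((1 + ε) ^ k)
  total : ∀ c ∈ C, ∀ i, ∑ j ∈ univ.filter (fun j => γ j = c ∧ ι j = i), I.p j / c.s ≤
    (1 + 2 * ε) * c.w

theorem IsMILPSolution.exists_isIntegral (hsol : IsMILPSolution ε I Copt sopt C x z) (hε : 0 < ε)
    (hε2 : ε ≤ 1 / 2) (hI : I.IsRounded ε) (hC : ∀ c ∈ C, c.IsFeasible ε I Copt) :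
    ∃ κ γ ι, IsIntegral ε I Copt C z κ γ ι := by
  classical
  have hε1 : ε < 1 := by linarith
  obtain ⟨κ, γ, hmem, hres, hcard⟩ := hsol.exists_integral
  have hcopy : ∀ c ∈ C, ∀ k ∈ c.periods ε, ∃ f : Fin I.n → ℕ,
      (∀ j ∈ univ.filter (fun j => κ j = k ∧ γ j = c), f j < ⌈z c⌉₊) ∧ ∀ i,
      ∑ j ∈ univ.filter (fun j => κ j = k ∧ γ j = c) with f j = i, I.p j / c.s ≤
        c.content ε k + ε ^ rho * (3 + 1 / ε) * c.w := by
    intro c hc k hk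
    refine hsol.exists_copies hε hε1 hI hc (hC c hc) hk _ (fun j hj => ?_) fun p => ?_
    · rw [← (mem_filter.1 hj).2.2]
      exact (hmem j).2.2.2
    · rw [filter_filter]
      exact hcard p k c hc
  choose! f hf1 hf2 using hcopy
  have hper : ∀ c ∈ C, ∀ i, ∀ k₀ ∈ c.periods ε, (1 + ε) ^ k₀ +
      ∑ j ∈ univ.filter (fun j => (γ j = c ∧ f (γ j) (κ j) j = i) ∧ k₀ ≤ κ j), I.p j / c.s ≤
        (1 + 2 * ε) * c.w := by
    intro c hc i k₀ hk₀
    have hw := IsPow.pos hε (hC c hc).load_pow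
    have hmaps : ∀ j ∈ univ.filter (fun j => (γ j = c ∧ f (γ j) (κ j) j = i) ∧ k₀ ≤ κ j),
        κ j ∈ (c.periods ε).filter fun k => k₀ ≤ k := fun j hj => by
      obtain ⟨⟨h1, -⟩, h2⟩ := (mem_filter.1 hj).2
      exact mem_filter.2 ⟨h1 ▸ (hmem j).2.1, h2⟩
    have hcontent := (hC c hc).content_le hε hε1 hk₀
    have hsum : ∑ j ∈ univ.filter (fun j => (γ j = c ∧ f (γ j) (κ j) j = i) ∧ k₀ ≤ κ j),
        I.p j / c.s ≤ ∑ k ∈ c.periods ε with k₀ ≤ k, c.content ε k + ε * c.w := by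
      calc _ ≤ ∑ k ∈ c.periods ε with k₀ ≤ k,
              (c.content ε k + ε ^ rho * (3 + 1 / ε) * c.w) := by
            rw [← sum_fiberwise_of_maps_to hmaps]
            refine sum_le_sum fun k hk => ?_
            have hkp := (mem_filter.1 hk).1
            refine le_trans (le_of_eq (sum_congr ?_ fun _ _ => rfl)) (hf2 c hc k hkp i)
            ext j
            simp only [mem_filter, mem_univ, true_and]
            constructor
            · rintro ⟨⟨⟨rfl, h2⟩, -⟩, rfl⟩
              exact ⟨⟨rfl, rfl⟩, h2⟩
            · rintro ⟨⟨rfl, rfl⟩, h2⟩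
              exact ⟨⟨⟨rfl, h2⟩, (mem_filter.1 hk).2⟩, rfl⟩
        _ ≤ _ := by
            rw [sum_add_distrib, sum_const, nsmul_eq_mul]
            refine add_le_add le_rfl ?_
            have h1 : (((c.periods ε).filter fun k => k₀ ≤ k).card : ℝ) ≤ muTilde ε := by
              rw [← Config.card_periods hε (hC c hc).load_pow hε1]
              exact_mod_cast card_filter_le _ _
            calc _ ≤ (muTilde ε : ℝ) * (ε ^ rho * (3 + 1 / ε) * c.w) := by gcongr
              _ = muTilde ε * (ε ^ rho * (3 + 1 / ε)) * c.w := by ring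
              _ ≤ _ := by gcongr; exact muTilde_mul_le hε hε2
    linarith
  have hbelow : ∀ c ∈ C, ∀ i k, k ≤ c.nuL ε → (1 + ε) ^ k +
      ∑ j ∈ univ.filter (fun j => γ j = c ∧ f (γ j) (κ j) j = i), I.p j / c.s ≤
        (1 + 2 * ε) * c.w := by
    intro c hc i k hk
    have h := hper c hc i (c.nuL ε)
      (mem_Icc.2 ⟨le_rfl, Config.nuL_le_nuU hε (hC c hc).load_pow hε1⟩)
    refine le_trans (add_le_add (zpow_le_zpow_right₀ (by linarith) hk) (le_of_eq ?_)) h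
    refine sum_congr (filter_congr fun j _ => ⟨fun hj => ⟨hj, ?_⟩, fun hj => hj.1⟩) fun _ _ => rfl
    exact hj.1 ▸ (mem_Icc.1 (hmem j).2.1).1
  refine ⟨κ, γ, fun j => f (γ j) (κ j) j, fun j => (hmem j).1, fun j => (hmem j).2.2.1, fun j => ?_,
    hres, fun c hc i k => ?_, fun c hc i => ?_⟩
  · exact hf1 (γ j) (hmem j).1 (κ j) (hmem j).2.1 j (by simp)
  · have hs : 0 < c.s := by
      obtain ⟨i, hi⟩ := (hC c hc).speed
      exact hi ▸ I.s_pos i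
    rcases lt_or_ge k (c.nuL ε) with h1 | h1
    · refine le_trans (le_trans ?_ (hbelow c hc i k h1.le)) (le_max_left _ _)
      refine add_le_add le_rfl ?_
      refine sum_le_sum_of_subset_of_nonneg (fun j hj => ?_) fun j _ _ =>
        div_nonneg (I.p_pos j).le hs.le
      exact mem_filter.2 ⟨mem_univ _, (mem_filter.1 hj).2.1⟩
    rcases le_or_gt k (c.nuU ε) with h2 | h2
    · exact (hper c hc i k (mem_Icc.2 ⟨h1, h2⟩)).trans (le_max_left _ _)
    · refine le_trans (le_of_eq ?_) (le_max_right _ _)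
      rw [add_eq_left, filter_eq_empty_iff.2, sum_empty]
      rintro j - ⟨⟨h3, -⟩, h4⟩
      have := (mem_Icc.1 (hmem j).2.1).2
      rw [h3] at this
      omega
  · have := hbelow c hc i (c.nuL ε) le_rfl
    have h2 : 0 < (1 + ε) ^ c.nuL ε := by positivity
    linarith

end Rounding

/-! ### From copies of configurations to machines -/

theorem zpow_le_of_mem_universalPeriods {ε : ℝ} (hε : 0 < ε) {I : Instance} {Copt : ℝ}
    (hC : IsPow ε Copt) {k : ℤ} (hk : k ∈ universalPeriods ε I Copt) :
    (1 + ε) ^ k ≤ (1 + ε) * Copt := by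
  obtain ⟨a, rfl⟩ := hC
  have h := (mem_Icc.1 hk).2
  rw [logb_zpow_base hε, Int.le_floor] at h
  have h' : k ≤ a + 1 := by exact_mod_cast h
  rw [mul_comm, ← zpow_add_one₀ (by positivity)]
  exact zpow_le_zpow_right₀ (by linarith) h'

/-- Jobs that start no earlier than the beginning of their periods do not run out of resource. -/
theorem resource_of_periods {ε : ℝ} (hε : 0 < ε) {I : Instance} {Copt : ℝ} (κ : Fin I.n → ℤ)
    (hκ : ∀ j, κ j ∈ universalPeriods ε I Copt)
    (hres : ∀ k ∈ universalPeriods ε I Copt, ∑ j with κ j ≤ k, I.d j ≤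
      ∑ k' ∈ universalPeriods ε I Copt with k' ≤ k, supply ε I k')
    (start : Fin I.n → ℝ) (hstart : ∀ j, (1 + ε) ^ κ j ≤ start j) (t : ℝ) :
    ∑ j with start j < t, I.d j ≤ ∑ k with I.u k < t, I.q k := by
  set P := (universalPeriods ε I Copt).filter fun k => (1 + ε) ^ k < t with hP
  have hjP : ∀ j, start j < t → κ j ∈ P := fun j hj =>
    mem_filter.2 ⟨hκ j, (hstart j).trans_lt hj⟩
  rcases P.eq_empty_or_nonempty with h | hne
  · rw [filter_eq_empty_iff.2 fun j _ hj => notMem_empty _ (h ▸ hjP j hj), sum_empty]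
    exact sum_nonneg fun k _ => I.q_nonneg k
  -- The last period that begins before `t`.
  set k := P.max' hne
  obtain ⟨hkK, hkt⟩ := mem_filter.1 (P.max'_mem hne)
  calc ∑ j with start j < t, I.d j ≤ ∑ j with κ j ≤ k, I.d j := by
        refine sum_le_sum_of_subset_of_nonneg (fun j hj => ?_) fun j _ _ => I.d_nonneg j
        exact mem_filter.2 ⟨mem_univ _, P.le_max' _ (hjP j (mem_filter.1 hj).2)⟩
    _ ≤ ∑ k' ∈ universalPeriods ε I Copt with k' ≤ k, supply ε I k' := hres k hkK
    _ = ∑ v ∈ ((universalPeriods ε I Copt).filter fun k' => k' ≤ k).biUnion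
          (fun k' => univ.filter fun v => I.u v = (1 + ε) ^ k'), I.q v := by
        rw [sum_biUnion]
        · rfl
        · intro a _ b _ hab
          refine disjoint_filter.2 fun v _ ha hb => hab ?_
          exact zpow_right_injective₀ (by linarith) (by linarith) (ha.symm.trans hb)
    _ ≤ ∑ v with I.u v < t, I.q v := by
        refine sum_le_sum_of_subset_of_nonneg (fun v hv => ?_) fun v _ _ => I.q_nonneg v
        obtain ⟨k', hk', hv⟩ := mem_biUnion.1 hv
        refine mem_filter.2 ⟨mem_univ _, ?_⟩
        rw [(mem_filter.1 hv).2]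
        exact (zpow_le_zpow_right₀ (by linarith) (mem_filter.1 hk').2).trans_lt hkt

section Machines

variable {ε : ℝ} {I : Instance} {Copt sopt : ℝ} {C : Finset Config}
  {x : Fin I.n → ℤ → Config → ℝ} {z : Config → ℝ}

/-- Speeds and load bounds close to `sopt` and `Copt` are above the threshold `κ`. -/
theorem kappa_le (hε : 0 < ε) (hε2 : ε ≤ 1 / 2) (hg : IsGuess ε I Copt sopt) :
    kappa ε sopt ≤ sopt ∧ (1 + ε) * kappa ε sopt ≤ 1 := by
  obtain ⟨i, hi⟩ := hg.sopt_speed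
  have hs0 : 0 < sopt := hi ▸ I.s_pos i
  have hs1 : sopt ≤ 1 := hi ▸ I.s_le_one i
  have h1 : 1 ≤ configBound ε := one_le_pow₀ (le_add_of_nonneg_left (by positivity))
  have h2 : 1 ≤ (1 + ε) ^ 3 / ε ^ 2 := by
    rw [le_div_iff₀ (by positivity), one_mul]
    have : 0 < ε ^ 3 := by positivity
    nlinarith
  have h3 : 1 ≤ (1 + 2 * ε) * configBound ε * ((1 + ε) ^ 3 / ε ^ 2) :=
    one_le_mul_of_one_le_of_one_le (one_le_mul_of_one_le_of_one_le (by linarith) h1) h2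
  have h4 : kappa ε sopt ≤ ε * sopt := div_le_self (by positivity) h3
  have h5 : ε * sopt ≤ ε := mul_le_of_le_one_right hε.le hs1
  constructor <;> nlinarith

/-- Some configuration for speed `sopt` with load bound close to `Copt` is used at least once. -/
theorem IsMILPSolution.exists_special (hsol : IsMILPSolution ε I Copt sopt C x z) (hε : 0 < ε)
    (hε2 : ε ≤ 1 / 2) (hg : IsGuess ε I Copt sopt) :
    ∃ c ∈ C, c.s = sopt ∧ Copt ≤ (1 + ε) * c.w ∧ 0 < ⌊z c⌋₊ := by
  have hC0 := IsPow.pos hε hg.Copt_pow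
  obtain ⟨h1, h2⟩ := kappa_le hε hε2 hg
  by_contra! hcon
  have := hsol.guessing
  rw [sum_eq_zero] at this
  · linarith
  intro c hc
  obtain ⟨hcC, hcs, hcw⟩ := mem_filter.1 hc
  have h0 := hcon c hcC hcs hcw
  obtain ⟨a, ha⟩ := hsol.z_integer c hcC (by rw [hcs]; exact h1) (by nlinarith)
  have hz := hsol.z_nonneg c hcC
  rw [Nat.le_zero, Nat.floor_eq_zero, ha] at h0
  rw [ha] at hz ⊢
  have h3 : a < 1 := by exact_mod_cast h0
  have h4 : 0 ≤ a := by exact_mod_cast hz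
  have : a = 0 := by omega
  simp [this]

/-- The `⌊z c⌋` integral copies of all configurations find distinct machines of their speeds. -/
theorem IsMILPSolution.exists_machines (hsol : IsMILPSolution ε I Copt sopt C x z)
    (hC : ∀ c ∈ C, c.IsFeasible ε I Copt) :
    ∃ F : ((c : C) × Fin ⌊z c⌋₊) → Fin I.m, Function.Injective F ∧
      ∀ a, I.s (F a) = a.1.1.s := by
  classical
  refine exists_injective_lift (fun a : (c : C) × Fin ⌊z c⌋₊ => a.1.1.s) I.s fun a => ?_
  obtain ⟨i, hi⟩ := (hC a.1 a.1.2).speed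
  have hm := hsol.machines i
  rw [hi] at hm
  have hcard : (univ.filter fun a' : (c : C) × Fin ⌊z c⌋₊ => a'.1.1.s = a.1.1.s).card =
      ∑ c ∈ C with c.s = a.1.1.s, ⌊z c⌋₊ := by
    rw [card_filter, Fintype.sum_sigma, sum_filter,
      ← sum_coe_sort C fun c => if c.s = a.1.1.s then ⌊z c⌋₊ else 0]
    refine sum_congr rfl fun c _ => ?_
    split_ifs with h <;> simp
  rw [hcard, ← Nat.cast_le (α := ℝ), ← hm]
  push_cast
  refine le_trans (sum_le_sum fun c hc => ?_) (le_of_eq (sum_congr (by ext; simp) fun _ _ => rfl))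
  exact Nat.floor_le (hsol.z_nonneg c (mem_filter.1 hc).1)

/-- The jobs on the last copies of configurations with fractional multiplicity take time at most
`2 ε Copt` on a machine of speed `sopt`. -/
theorem IsMILPSolution.fractional_le (hsol : IsMILPSolution ε I Copt sopt C x z) (hε : 0 < ε)
    (hε1 : ε < 1) (hI : I.IsRounded ε) (hg : IsGuess ε I Copt sopt)
    (hC : ∀ c ∈ C, c.IsFeasible ε I Copt) {κ : Fin I.n → ℤ} {γ : Fin I.n → Config}
    {ι : Fin I.n → ℕ} (h : IsIntegral ε I Copt C z κ γ ι) :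
    ∑ j with ⌊z (γ j)⌋₊ ≤ ι j, I.p j / sopt ≤ 2 * ε * Copt := by
  classical
  have hso : 0 < sopt := by
    obtain ⟨i, hi⟩ := hg.sopt_speed
    exact hi ▸ I.s_pos i
  set D := C.filter fun c => ⌊z c⌋₊ < ⌈z c⌉₊ with hD
  have hfrac := sum_slow_or_light_le hε hε1 hI hg D (fun c hc => hC c (mem_filter.1 hc).1)
    fun c hc => by
      obtain ⟨hcC, hlt⟩ := mem_filter.1 hc
      by_contra! hge
      obtain ⟨a, ha⟩ := hsol.z_integer c hcC hge.1 hge.2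
      have ha0 : 0 ≤ a := by
        have := hsol.z_nonneg c hcC
        rw [ha] at this
        exact_mod_cast this
      obtain ⟨b, rfl⟩ := Int.eq_ofNat_of_zero_le ha0
      rw [ha, Int.cast_natCast, Nat.floor_natCast, Nat.ceil_natCast] at hlt
      exact lt_irrefl _ hlt
  rw [← sum_div, div_le_iff₀ hso]
  refine le_trans ?_ hfrac
  have hmaps : ∀ j ∈ univ.filter (fun j => ⌊z (γ j)⌋₊ ≤ ι j), γ j ∈ D := fun j hj =>
    mem_filter.2 ⟨h.mem j, (mem_filter.1 hj).2.trans_lt (h.copy_lt j)⟩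
  rw [← sum_fiberwise_of_maps_to hmaps]
  refine sum_le_sum fun c hc => ?_
  have hcC := (mem_filter.1 hc).1
  have hs : 0 < c.s := by
    obtain ⟨i, hi⟩ := (hC c hcC).speed
    exact hi ▸ I.s_pos i
  have ht := h.total c hcC ⌊z c⌋₊
  rw [← sum_div, div_le_iff₀ hs] at ht
  refine le_trans ?_ (ht.trans (le_of_eq (mul_comm _ _)))
  refine sum_le_sum_of_subset_of_nonneg (fun j hj => ?_) fun j _ _ => (I.p_pos j).le
  obtain ⟨h1, rfl⟩ := mem_filter.1 hj
  have h2 := (mem_filter.1 h1).2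
  have h3 := h.copy_lt j
  have h4 := Nat.ceil_le_floor_add_one (z (γ j))
  exact mem_filter.2 ⟨mem_univ _, rfl, by omega⟩

/-- The schedule with its deadlines: distinct machines for the integral copies of configurations,
loads bounded in terms of load bounds and of the guessed makespan, other machines being empty. -/
theorem IsMILPSolution.exists_schedule (hsol : IsMILPSolution ε I Copt sopt C x z) (hε : 0 < ε)
    (hε2 : ε ≤ 1 / 2) (hI : I.IsRounded ε) (hg : IsGuess ε I Copt sopt)
    (hC : ∀ c ∈ C, c.IsFeasible ε I Copt) :
    ∃ (σ : Schedule I) (F : ((c : C) × Fin ⌊z c⌋₊) → Fin I.m), σ.IsFeasible ∧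
      Function.Injective F ∧ (∀ a, σ.load (F a) ≤ (1 + 6 * ε) * a.1.1.w) ∧
      (∀ i, σ.load i ≤ (1 + 6 * ε) * Copt) ∧ ∀ i ∉ Set.range F, σ.load i = 0 := by
  classical
  have hε1 : ε < 1 := by linarith
  have hC0 := IsPow.pos hε hg.Copt_pow
  obtain ⟨κ, γ, ι, h⟩ := hsol.exists_isIntegral hε hε2 hI hC
  obtain ⟨c₀, hc₀, hs₀, hw₀, hz₀⟩ := hsol.exists_special hε hε2 hg
  obtain ⟨F, hF, hFs⟩ := hsol.exists_machines hC
  have hextra := hsol.fractional_le hε hε1 hI hg hC h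
  have hw : ∀ c ∈ C, 0 < c.w := fun c hc => IsPow.pos hε (hC c hc).load_pow
  have hs : ∀ c ∈ C, 0 < c.s := fun c hc => by
    obtain ⟨i, hi⟩ := (hC c hc).speed
    exact hi ▸ I.s_pos i
  -- Jobs on fractional copies join the first copy `a₀` of `c₀`.
  let a₀ : (c : C) × Fin ⌊z c⌋₊ := ⟨⟨c₀, hc₀⟩, ⟨0, hz₀⟩⟩
  let α : Fin I.n → (c : C) × Fin ⌊z c⌋₊ := fun j =>
    if hj : ι j < ⌊z (γ j)⌋₊ then ⟨⟨γ j, h.mem j⟩, ⟨ι j, hj⟩⟩ else a₀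
  have hα : ∀ j, ι j < ⌊z (γ j)⌋₊ → (α j).1.1 = γ j ∧ ((α j).2 : ℕ) = ι j := fun j hj => by
    have h1 : α j = ⟨⟨γ j, h.mem j⟩, ⟨ι j, hj⟩⟩ := dif_pos hj
    rw [h1]
    exact ⟨rfl, rfl⟩
  have hα' : ∀ j, ¬ ι j < ⌊z (γ j)⌋₊ → α j = a₀ := fun j hj => by simp only [α, dif_neg hj]
  let D : ((c : C) × Fin ⌊z c⌋₊) → ℝ := fun a =>
    if a = a₀ then max ((1 + 2 * ε) * c₀.w) ((1 + ε) * Copt) + 2 * ε * Copt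
    else (1 + 2 * ε) * a.1.1.w
  have hDw : ∀ a, D a ≤ (1 + 6 * ε) * a.1.1.w := by
    intro a
    have haw := hw _ a.1.2
    simp only [D]
    split_ifs with ha
    · subst ha
      change _ ≤ (1 + 6 * ε) * c₀.w
      change 0 < c₀.w at haw
      have h1 : ε * Copt ≤ ε * ((1 + ε) * c₀.w) := by gcongr
      have h2 : ε * ε * c₀.w ≤ 1 / 2 * ε * c₀.w := by gcongr
      have h3 : 0 < ε * c₀.w := by positivity
      rw [← le_sub_iff_add_le]
      refine max_le ?_ ?_ <;> linarith
    · gcongr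
      linarith
  have hDC : ∀ a, D a ≤ (1 + 6 * ε) * Copt := by
    have key : ∀ c ∈ C, (1 + 2 * ε) * c.w + 2 * ε * Copt ≤ (1 + 6 * ε) * Copt := fun c hc => by
      have h1 : (1 + 2 * ε) * c.w ≤ (1 + 2 * ε) * ((1 + ε) * Copt) := by
        gcongr; exact (hC c hc).load_le
      have h2 : ε * ε * Copt ≤ 1 / 2 * ε * Copt := by gcongr
      linarith
    have hpos : 0 < ε * Copt := by positivity
    intro a
    simp only [D]
    split_ifs with ha
    · rw [← le_sub_iff_add_le]
      refine max_le ?_ ?_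
      · linarith [key c₀ hc₀]
      · linarith
    · linarith [key a.1 a.1.2]
  have hD0 : ∀ a, 0 ≤ D a := by
    intro a
    have haw := hw _ a.1.2
    have := hw c₀ hc₀
    simp only [D]
    split_ifs with ha <;> positivity
  set G : Fin I.m → ℝ := Function.extend F D 0 with hG
  have hGF : ∀ a, G (F a) = D a := fun a => hF.extend_apply D 0 a
  have hnn : ∀ c ∈ C, ∀ j, 0 ≤ I.p j / c.s := fun c hc j =>
    div_nonneg (I.p_pos j).le (hs c hc).le
  have hbd : ∀ j, (1 + ε) ^ κ j + ∑ j' with F (α j') = F (α j) ∧ (1 + ε) ^ κ j ≤ (1 + ε) ^ κ j',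
      I.p j' / I.s (F (α j)) ≤ G (F (α j)) := by
    intro j
    rw [hGF, hFs]
    have hκle : ∀ j', (1 + ε) ^ κ j ≤ (1 + ε) ^ κ j' → κ j ≤ κ j' := fun j' hj' =>
      (zpow_le_zpow_iff_right₀ (by linarith)).1 hj'
    by_cases ha : α j = a₀
    · simp only [D, ha, if_true]
      change _ + ∑ j' with F (α j') = F a₀ ∧ _, I.p j' / c₀.s ≤ _
      have hsub : univ.filter (fun j' => F (α j') = F a₀ ∧ (1 + ε) ^ κ j ≤ (1 + ε) ^ κ j') ⊆
          univ.filter (fun j' => (γ j' = c₀ ∧ ι j' = 0) ∧ κ j ≤ κ j') ∪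
            univ.filter (fun j' => ⌊z (γ j')⌋₊ ≤ ι j') := by
        intro j' hj'
        obtain ⟨h1, h2⟩ := (mem_filter.1 hj').2
        have h1 := hF h1
        rw [mem_union, mem_filter, mem_filter]
        by_cases hr : ι j' < ⌊z (γ j')⌋₊
        · obtain ⟨h3, h4⟩ := hα j' hr
          rw [h1] at h3 h4
          exact Or.inl ⟨mem_univ _, ⟨h3.symm, h4.symm⟩, hκle j' h2⟩
        · exact Or.inr ⟨mem_univ _, not_lt.1 hr⟩
      have hle := sum_le_sum_of_subset_of_nonneg (f := fun j' => I.p j' / c₀.s) hsub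
        fun j' _ _ => hnn c₀ hc₀ j'
      have hun := sum_union_inter (f := fun j' => I.p j' / c₀.s)
        (s₁ := univ.filter (fun j' => (γ j' = c₀ ∧ ι j' = 0) ∧ κ j ≤ κ j'))
        (s₂ := univ.filter (fun j' => ⌊z (γ j')⌋₊ ≤ ι j'))
      have hinter : 0 ≤ ∑ j' ∈ univ.filter (fun j' => (γ j' = c₀ ∧ ι j' = 0) ∧ κ j ≤ κ j') ∩
          univ.filter (fun j' => ⌊z (γ j')⌋₊ ≤ ι j'), I.p j' / c₀.s :=
        sum_nonneg fun j' _ => hnn c₀ hc₀ j'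
      have hown := h.load c₀ hc₀ 0 (κ j)
      have hmax : max ((1 + 2 * ε) * c₀.w) ((1 + ε) ^ κ j) ≤
          max ((1 + 2 * ε) * c₀.w) ((1 + ε) * Copt) :=
        max_le_max le_rfl (zpow_le_of_mem_universalPeriods hε hg.Copt_pow (h.period j))
      rw [← hs₀] at hextra
      linarith
    · have hr : ι j < ⌊z (γ j)⌋₊ := by
        by_contra hr
        exact ha (hα' j hr)
      obtain ⟨h1, h2⟩ := hα j hr
      simp only [D, if_neg ha]
      rw [h1]
      have hsub : univ.filter (fun j' => F (α j') = F (α j) ∧ (1 + ε) ^ κ j ≤ (1 + ε) ^ κ j') ⊆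
          univ.filter (fun j' => (γ j' = γ j ∧ ι j' = ι j) ∧ κ j ≤ κ j') := by
        intro j' hj'
        obtain ⟨h3, h4⟩ := (mem_filter.1 hj').2
        have h3 := hF h3
        have hr' : ι j' < ⌊z (γ j')⌋₊ := by
          by_contra hr'
          exact ha (h3.symm.trans (hα' j' hr'))
        obtain ⟨h5, h6⟩ := hα j' hr'
        rw [h3] at h5 h6
        exact mem_filter.2 ⟨mem_univ _, ⟨h5.symm.trans h1, h6.symm.trans h2⟩, hκle j' h4⟩
      have hle := sum_le_sum_of_subset_of_nonneg (f := fun j' => I.p j' / (γ j).s) hsub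
        fun j' _ _ => hnn _ (h.mem j) j'
      have hpos : I.p j / (γ j).s ≤
          ∑ j' with (γ j' = γ j ∧ ι j' = ι j) ∧ κ j ≤ κ j', I.p j' / (γ j).s :=
        single_le_sum (f := fun j' => I.p j' / (γ j).s) (fun j' _ => hnn _ (h.mem j) j') (by simp)
      have hpj : 0 < I.p j / (γ j).s := div_pos (I.p_pos j) (hs _ (h.mem j))
      -- Since job `j` itself belongs to the copy, the bound is not the trivial one.
      have hload := h.load (γ j) (h.mem j) (ι j) (κ j)
      rcases le_max_iff.1 hload with h3 | h3 <;> linarith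
  obtain ⟨σ, hσμ, hσr, hσG, hσo⟩ := UMS.exists_schedule I (fun j => F (α j))
    (fun j => (1 + ε) ^ κ j) G hbd
  have hload : ∀ i, 0 ≤ G i → σ.load i ≤ G i := fun i hi => by
    rw [Schedule.load, fold_max_le]
    refine ⟨hi, fun j hj => (hσG j).trans (le_of_eq ?_)⟩
    rw [← (mem_filter.1 hj).2, hσμ]
  have hempty : ∀ i ∉ Set.range F, σ.load i = 0 := fun i hi => by
    rw [Schedule.load, filter_eq_empty_iff.2, fold_empty]
    rintro j - hj
    rw [hσμ] at hj
    exact hi ⟨_, hj⟩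
  refine ⟨σ, F, ⟨fun j => le_trans (by positivity) (hσr j), hσo, fun t =>
    resource_of_periods hε κ h.period h.resource σ.start hσr t⟩, hF, fun a => ?_, fun i => ?_, hempty⟩
  · exact (hload _ (by rw [hGF]; exact hD0 a)).trans (by rw [hGF]; exact hDw a)
  · by_cases hi : i ∈ Set.range F
    · obtain ⟨a, rfl⟩ := hi
      exact (hload _ (by rw [hGF]; exact hD0 a)).trans (by rw [hGF]; exact hDC a)
    · rw [hempty i hi]
      positivity

end Machines

end UMS

end

theorem theorem2 (ε φ ψ : ℝ) (hε : 0 < ε) (hε1 : ε < 1) (hεint : ∃ N : ℕ, 1 / ε = N)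
    (hφ : 1 < φ) (hψ0 : 0 ≤ ψ) (hψ1 : ψ ≤ 1)
    (I : UMS.Instance) (hI : I.IsRounded ε)
    (Copt sopt : ℝ) (hguess : UMS.IsGuess ε I Copt sopt)
    (C : Finset UMS.Config) (hC : ∀ c ∈ C, c.IsFeasible ε I Copt)
    (x : Fin I.n → ℤ → UMS.Config → ℝ) (z : UMS.Config → ℝ)
    (hsol : UMS.IsMILPSolution ε I Copt sopt C x z) :
    ∃ σ : UMS.Schedule I, σ.IsFeasible ∧
      σ.obj ψ φ ≤ (1 + 6 * ε) ^ φ * UMS.milpCost ψ φ Copt C z := by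
  classical
  have hC0 := UMS.IsPow.pos hε hguess.Copt_pow
  obtain ⟨σ, F, hσ, hF, hw, hCopt, hrest⟩ := hsol.exists_schedule hε
    (UMS.le_half_of_integral hε hε1 hεint) hI hguess hC
  refine ⟨σ, hσ, ?_⟩
  have hload0 : ∀ i, 0 ≤ σ.load i := fun i => Finset.le_fold_max _ |>.2 (Or.inl le_rfl)
  have hmax : σ.makespan ≤ (1 + 6 * ε) ^ φ * Copt := by
    have h1 : 1 + 6 * ε ≤ (1 + 6 * ε) ^ φ := Real.self_le_rpow_of_one_le (by linarith) hφ.le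
    have h2 : σ.makespan ≤ (1 + 6 * ε) * Copt := by
      rw [UMS.Schedule.makespan, Finset.fold_max_le]
      exact ⟨by positivity, fun i _ => hCopt i⟩
    exact h2.trans (by gcongr)
  have hsum : ∑ i, σ.load i ^ φ ≤ (1 + 6 * ε) ^ φ * ∑ c ∈ C, z c * c.w ^ φ := by
    calc ∑ i, σ.load i ^ φ = ∑ i ∈ univ.image F, σ.load i ^ φ := by
          refine (sum_subset (subset_univ _) fun i _ hi => ?_).symm
          rw [hrest i fun ⟨a, ha⟩ => hi (mem_image.2 ⟨a, mem_univ _, ha⟩),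
            Real.zero_rpow (by linarith)]
      _ = ∑ a, σ.load (F a) ^ φ := sum_image fun a _ b _ h => hF h
      _ ≤ ∑ a : (c : C) × Fin ⌊z c⌋₊, (1 + 6 * ε) ^ φ * a.1.1.w ^ φ := by
          refine sum_le_sum fun a _ => ?_
          have := UMS.IsPow.pos hε (hC a.1 a.1.2).load_pow
          rw [← Real.mul_rpow (by positivity) this.le]
          exact Real.rpow_le_rpow (hload0 _) (hw a) (by linarith)
      _ = (1 + 6 * ε) ^ φ * ∑ c ∈ C, ⌊z c⌋₊ * c.w ^ φ := by
          rw [← mul_sum, Fintype.sum_sigma, ← sum_coe_sort C fun c => (⌊z c⌋₊ : ℝ) * c.w ^ φ]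
          simp
      _ ≤ _ := by
          refine mul_le_mul_of_nonneg_left (sum_le_sum fun c hc => ?_) (by positivity)
          have := UMS.IsPow.pos hε (hC c hc).load_pow
          gcongr
          exact Nat.floor_le (hsol.z_nonneg c hc)
  calc σ.obj ψ φ ≤ ψ * ((1 + 6 * ε) ^ φ * Copt) +
        (1 - ψ) * ((1 + 6 * ε) ^ φ * ∑ c ∈ C, z c * c.w ^ φ) :=
        add_le_add (mul_le_mul_of_nonneg_left hmax hψ0)
          (mul_le_mul_of_nonneg_left hsum (by linarith))
    _ = _ := by rw [UMS.milpCost]; ring
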